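/- Let $k$ be a field of characteristic zero and let $A=\bigoplus_{i\ge 0}A_i$ be a nonzero standard graded artinian $k$-algebra, that is, a commutative artinian graded $k$-algebra with $A_0=k$, $\dim_k A_1<\infty$, and generated by $A_1$ as a $k$-algebra. Put $h_i=\dim_k A_i$ for $i\ge 0$ and $h_i=0$ for $i<0$, and let $D$ be the socle degree of $A$, i.e. the largest $i$ with $h_i\neq 0$. A graded $k$-algebra $C$ has the weak Lefschetz property (WLP) if there is $\ell\in C_1$ such that every multiplication map $\cdot\ell\colon C_i\to C_{i+1}$, $i\ge 0$, is injective or surjective; it has the strong Lefschetz property (SLP) if there is $\ell\in C_1$ such that every map $\cdot\ell^t\colon C_i\to C_{i+t}$, $i,t\ge 0$, is injective or surjective. The algebra $A$ is almost centered if for all $i<j$: $h_i<h_j$ implies $h_{i-s}\le h_{j+s}$ for all $s\ge 0$, and $h_i>h_j$ implies $h_{i-s}\ge h_{j+s}$ for all $s\ge 0$. Variables have degree one, and tensor products over $k$ are graded by total degree. Then the following are equivalent. (1) $A$ is almost centered and has the SLP. (2) $A$ has the SLP, and either $h_{i-1}\le h_{D-i}\le h_i$ for all $0\le i\le\lfloor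 D/2\rfloor$, or $h_{D-i+1}\le h_i\le h_{D-i}$ for all $0\le i\le\lfloor D/2\rfloor$. (3) $A\otimes_k k[x]/(x^d)$ has the SLP for all $d\ge 1$. (4) $A\otimes_k k[x_1,\dots,x_n]/(x_1^{d_1},\dots,x_n^{d_n})$ has the SLP for all $n\ge 0$ and all $d_1,\dots,d_n\ge 1$. (5) $A\otimes_k k[x_1,\dots,x_n]/(x_1^2,\dots,x_n^2)$ has the WLP for all $n\ge 0$. -/

import Mathlib

open scoped TensorProduct

namespace Lefschetz

section General

variable {k A : Type*} [Field k] [CommRing A] [Algebra k A]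

/-- A graded `k`-algebra `A = ⨁ 𝒜 i` is standard graded if `𝒜 0 = k`, the space `𝒜 1` is
finite-dimensional, and `A` is generated by `𝒜 1` as a `k`-algebra. Equivalently, `A` is a quotient
of some `k[x_1, …, x_n]` (all variables of degree one) by a proper homogeneous ideal, or `A = 0`. -/
structure IsStandardGraded (𝒜 : ℕ → Submodule k A) [GradedAlgebra 𝒜] : Prop where
  zero_eq : 𝒜 0 = 1
  finite_one : Module.Finite k (𝒜 1)
  adjoin_one : Algebra.adjoin k (𝒜 1 : Set A) = ⊤

/-- `D` is the socle degree: the largest degree in which the algebra is non-zero. -/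
def IsSocleDegree (𝒜 : ℕ → Submodule k A) (D : ℕ) : Prop :=
  IsGreatest {i : ℕ | Module.finrank k (𝒜 i) ≠ 0} D

/-- The Hilbert function `h_i = dim_k A_i`, for all integers `i`, with `h_i = 0` for `i < 0`. -/
noncomputable def hilbert (𝒜 : ℕ → Submodule k A) (i : ℤ) : ℕ :=
  if 0 ≤ i then Module.finrank k (𝒜 i.toNat) else 0

/-- The multiplication map `· f : 𝒜 i → 𝒜 j` (for `f` of degree `j - i`) has full rank:
it is injective or surjective. -/
def MulFullRank (𝒜 : ℕ → Submodule k A) (f : A) (i j : ℕ) : Prop :=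
  Set.InjOn (fun a => f * a) (𝒜 i : Set A) ∨
    Set.SurjOn (fun a => f * a) (𝒜 i : Set A) (𝒜 j : Set A)

/-- The weak Lefschetz property. -/
def HasWLP (𝒜 : ℕ → Submodule k A) : Prop :=
  ∃ l ∈ 𝒜 1, ∀ i : ℕ, MulFullRank 𝒜 l i (i + 1)

/-- The strong Lefschetz property. -/
def HasSLP (𝒜 : ℕ → Submodule k A) : Prop :=
  ∃ l ∈ 𝒜 1, ∀ t i : ℕ, MulFullRank 𝒜 (l ^ t) i (i + t)

/-- Almost centered algebras. -/
def IsAlmostCentered (𝒜 : ℕ → Submodule k A) : Prop :=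
  (∀ i j : ℤ, i < j → hilbert 𝒜 i < hilbert 𝒜 j →
    ∀ s : ℕ, hilbert 𝒜 (i - s) ≤ hilbert 𝒜 (j + s)) ∧
  (∀ i j : ℤ, i < j → hilbert 𝒜 j < hilbert 𝒜 i →
    ∀ s : ℕ, hilbert 𝒜 (j + s) ≤ hilbert 𝒜 (i - s))

/-- The total-degree grading of `A ⊗ B`: in degree `n` it is the sum of the `𝒜 i ⊗ ℬ j`
with `i + j = n`. -/
def tensorGrading {B : Type*} [CommRing B] [Algebra k B]
    (𝒜 : ℕ → Submodule k A) (ℬ : ℕ → Submodule k B) (n : ℕ) : Submodule k (A ⊗[k] B) :=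
  ⨆ p ∈ Finset.HasAntidiagonal.antidiagonal n, Submodule.map₂ (TensorProduct.mk k A B) (𝒜 p.1) (ℬ p.2)

/-- The grading induced on a quotient `A ⧸ I` (for `I` homogeneous): the images of the `𝒜 n`. -/
def quotientGrading (𝒜 : ℕ → Submodule k A) (I : Ideal A) (n : ℕ) : Submodule k (A ⧸ I) :=
  (𝒜 n).map (Ideal.Quotient.mkₐ k I).toLinearMap

end General

section Truncated

variable (k : Type*) [Field k]

/-- The algebra `k[x]/(x^d)`. -/
abbrev TruncPoly (d : ℕ) : Type _ :=
  Polynomial k ⧸ Ideal.span {(Polynomial.X : Polynomial k) ^ d}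

/-- The grading of `k[x]/(x^d)` with `x` in degree one. -/
noncomputable def truncPolyGrading (d : ℕ) : ℕ → Submodule k (TruncPoly k d) :=
  quotientGrading (fun n => LinearMap.range (Polynomial.monomial (R := k) n)) _

/-- The monomial complete intersection `k[x_1, …, x_n]/(x_1^{d_1}, …, x_n^{d_n})`. -/
abbrev MonomialCI {n : ℕ} (d : Fin n → ℕ) : Type _ :=
  MvPolynomial (Fin n) k ⧸
    Ideal.span (Set.range fun i : Fin n => (MvPolynomial.X i : MvPolynomial (Fin n) k) ^ d i)

/-- The standard grading of `k[x_1, …, x_n]/(x_1^{d_1}, …, x_n^{d_n})`. -/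
noncomputable def monomialCIGrading {n : ℕ} (d : Fin n → ℕ) :
    ℕ → Submodule k (MonomialCI k d) :=
  quotientGrading (MvPolynomial.homogeneousSubmodule (Fin n) k) _

end Truncated

end Lefschetz

/-! Everything is compared with one condition on a linear form `l`, namely `Balanced` for some `s`:
each Jordan string of `l` starts and ends in degrees whose sum is `s` or `s + 1`. Given the SLP, the
two alternatives of (2) say that `l` is balanced with `s = D - 1` or `s = D` (`exists_balanced`).
Conversely a balanced form has full-rank powers, and its injections and surjections make the algebra
almost centered. Almost centeredness gives (2) by shifting a bad pair of degrees outwards past the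
ends of the algebra.

Balance survives tensoring with `k[x]/(x^d)`, with `s` replaced by `s + d - 1`. By the
Clebsch–Gordan rule, a string from degree `a` to degree `b`, tensored with the string of `x`, splits
into strings whose end degrees all sum to `a + b + d - 1`. The proof avoids the decomposition: it
works in `C[X]` modulo `X^d` and passes from `d` to `d + 1` by differentiating (`truncInj_succ`,
`truncSurj_succ`). Adjoining the variables one at a time gives (3) and (4).

For the converse, suppose `l` is not balanced. Then some power of `l` fails to be injective and some
power fails to be surjective between degrees with the same sum (`exists_not_powInj_not_powSurj`).
Both failures pass to one and the same multiplication map on a suitable extension, contradicting the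
Lefschetz property there. The transfer has two directions: `powInj_add` and `powSurj_add` trade
exponent `t` for `t + g`, while `powInj_sub` and `powSurj_sub` trade `t + 1 + g` for `t + 1` by
truncating `(l + cX)^(-n)`. The Lefschetz form may vary with the extension, but full rank is a
generic condition, `k` is infinite, and only finitely many extensions are involved, so a single `l`
serves them all. -/

namespace Lefschetz
open Polynomial

/-! ### Powers of a linear form on a graded algebra -/

section Powers

variable {k C : Type*} [Field k] [CommRing C] [Algebra k C]

/-- Multiplication by `L ^ t` is injective on the piece of degree `i`. -/
def PowInj (𝒞 : ℤ → Submodule k C) (L : C) (i : ℤ) (t : ℕ) : Prop :=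
  ∀ a ∈ 𝒞 i, L ^ t * a = 0 → a = 0

/-- Multiplication by `L ^ t` maps the piece of degree `i` onto the piece of degree `i + t`. -/
def PowSurj (𝒞 : ℤ → Submodule k C) (L : C) (i : ℤ) (t : ℕ) : Prop :=
  ∀ b ∈ 𝒞 (i + t), ∃ a ∈ 𝒞 i, L ^ t * a = b

/-- Multiplication by `L` raises the degree by one. -/
def RaisesDegree (𝒞 : ℤ → Submodule k C) (L : C) : Prop :=
  ∀ i, ∀ a ∈ 𝒞 i, L * a ∈ 𝒞 (i + 1)

/-- The powers of `L` are injective between degrees whose sum is at most `s`, and surjective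
between degrees whose sum exceeds `s`. Equivalently, all Jordan strings of `L` start and end in
degrees whose sum is `s` or `s + 1`. -/
structure Balanced (𝒞 : ℤ → Submodule k C) (L : C) (s : ℤ) : Prop where
  inj : ∀ (i : ℤ) (t : ℕ), 2 * i + t ≤ s → PowInj 𝒞 L i t
  surj : ∀ (i : ℤ) (t : ℕ), s < 2 * i + t → PowSurj 𝒞 L i t

theorem RaisesDegree.pow {𝒞 : ℤ → Submodule k C} {L : C} (h : RaisesDegree 𝒞 L) (t : ℕ) {i : ℤ}
    {a : C} (ha : a ∈ 𝒞 i) : L ^ t * a ∈ 𝒞 (i + t) := by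
  induction t with
  | zero => simpa using ha
  | succ t ih =>
    have := h _ _ ih
    rw [pow_succ', mul_assoc]
    convert this using 2
    push_cast; ring

theorem PowInj.mono {𝒞 : ℤ → Submodule k C} {L : C} {i : ℤ} {t u : ℕ} (h : PowInj 𝒞 L i u)
    (htu : t ≤ u) : PowInj 𝒞 L i t := by
  intro a ha h0
  refine h a ha ?_
  obtain ⟨r, rfl⟩ := Nat.exists_eq_add_of_le' htu
  rw [pow_add, mul_assoc, h0, mul_zero]

theorem PowSurj.mono {𝒞 : ℤ → Submodule k C} {L : C} (hL : RaisesDegree 𝒞 L) {i j : ℤ} {t u : ℕ}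
    (h : PowSurj 𝒞 L i u) (htu : t ≤ u) (hij : i + u = j + t) : PowSurj 𝒞 L j t := by
  intro b hb
  rw [← hij] at hb
  obtain ⟨a, ha, rfl⟩ := h b hb
  obtain ⟨r, rfl⟩ := Nat.exists_eq_add_of_le' htu
  refine ⟨L ^ r * a, ?_, by ring⟩
  convert hL.pow r ha using 2
  push_cast at hij; linarith

theorem PowInj.of_eq_bot {𝒞 : ℤ → Submodule k C} {L : C} {i : ℤ} {t : ℕ} (h : 𝒞 i = ⊥) :
    PowInj 𝒞 L i t := by
  intro a ha _
  rwa [h, Submodule.mem_bot] at ha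

theorem PowSurj.of_eq_bot {𝒞 : ℤ → Submodule k C} {L : C} {i : ℤ} {t : ℕ} (h : 𝒞 (i + t) = ⊥) :
    PowSurj 𝒞 L i t := by
  intro b hb
  rw [h, Submodule.mem_bot] at hb
  exact ⟨0, zero_mem _, by simp [hb]⟩

end Powers

/-! ### The graded ring `C[X]` and powers of `l + cX` modulo `X ^ d` -/

section PolynomialGrading

variable {k C : Type*} [Field k] [CommRing C] [Algebra k C]

/-- The total-degree grading of `C[X]`, with `X` in degree one. -/
def polyGrading (𝒞 : ℤ → Submodule k C) (n : ℤ) : Submodule k C[X] where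
  carrier := {p | ∀ e : ℕ, p.coeff e ∈ 𝒞 (n - e)}
  add_mem' hp hq e := by simpa using add_mem (hp e) (hq e)
  zero_mem' e := by simp
  smul_mem' c p hp e := by simpa using Submodule.smul_mem _ c (hp e)

variable {𝒞 : ℤ → Submodule k C}

theorem derivative_mem_polyGrading {n : ℤ} {p : C[X]} (hp : p ∈ polyGrading 𝒞 n) :
    derivative p ∈ polyGrading 𝒞 (n - 1) := by
  intro e
  rw [coeff_derivative]
  have := Submodule.smul_mem _ ((e + 1 : ℕ) : k) (hp (e + 1))
  rw [Nat.cast_smul_eq_nsmul, nsmul_eq_mul, mul_comm] at this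
  convert this using 2
  · push_cast; ring
  · push_cast; ring

theorem X_mul_mem_polyGrading {n : ℤ} {p : C[X]} (hp : p ∈ polyGrading 𝒞 n) :
    X * p ∈ polyGrading 𝒞 (n + 1) := by
  rintro (_ | e)
  · simp
  · rw [coeff_X_mul]
    convert hp e using 2
    push_cast; ring

theorem C_mem_polyGrading {n : ℤ} {a : C} (ha : a ∈ 𝒞 n) :
    Polynomial.C a ∈ polyGrading 𝒞 n := by
  rintro (_ | e)
  · simpa using ha
  · rw [coeff_C_succ]; exact zero_mem _

theorem C_mul_X_pow_mem_polyGrading {n m : ℤ} {e : ℕ} {a : C} (ha : a ∈ 𝒞 n) (h : n + e = m) :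
    Polynomial.C a * X ^ e ∈ polyGrading 𝒞 m := by
  intro f
  rw [coeff_C_mul_X_pow]
  split_ifs with hf
  · convert ha using 2
    rw [← h, hf]; ring
  · exact zero_mem _

/-- The linear form `ℓ + c X`. -/
noncomputable def linForm (l : C) (c : k) : C[X] := Polynomial.C l + c • X

theorem raisesDegree_linForm {l : C} (hl : RaisesDegree 𝒞 l) (c : k) :
    RaisesDegree (polyGrading 𝒞) (linForm l c) := by
  intro i p hp
  rw [linForm, add_mul]
  refine add_mem (fun e => ?_) ?_
  · rw [coeff_C_mul]
    convert hl _ _ (hp e) using 2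
    ring
  · rw [smul_mul_assoc]
    exact Submodule.smul_mem _ c (X_mul_mem_polyGrading hp)

theorem derivative_linForm_one (l : C) : derivative (linForm l (1 : k)) = 1 := by
  simp [linForm]

/-- `N ^ t` is injective in degree `i` modulo `X ^ d`. -/
def TruncInj (𝒞 : ℤ → Submodule k C) (N : C[X]) (d : ℕ) (i : ℤ) (t : ℕ) : Prop :=
  ∀ p ∈ polyGrading 𝒞 i, X ^ d ∣ N ^ t * p → X ^ d ∣ p

/-- `N ^ t` is surjective from degree `i` to degree `i + t` modulo `X ^ d`. -/
def TruncSurj (𝒞 : ℤ → Submodule k C) (N : C[X]) (d : ℕ) (i : ℤ) (t : ℕ) : Prop :=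
  ∀ q ∈ polyGrading 𝒞 (i + t), ∃ p ∈ polyGrading 𝒞 i, X ^ d ∣ N ^ t * p - q

theorem truncInj_one {l : C} {c : k} {i : ℤ} {t : ℕ} (h : PowInj 𝒞 l i t) :
    TruncInj 𝒞 (linForm l c) 1 i t := by
  intro p hp hd
  rw [pow_one, X_dvd_iff] at hd ⊢
  rw [mul_coeff_zero, coeff_zero_eq_eval_zero (_ ^ t), eval_pow] at hd
  refine h _ (by simpa using hp 0) ?_
  simpa [linForm] using hd

theorem truncSurj_one {l : C} {c : k} {i : ℤ} {t : ℕ} (h : PowSurj 𝒞 l i t) :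
    TruncSurj 𝒞 (linForm l c) 1 i t := by
  intro q hq
  obtain ⟨a, ha, hab⟩ := h _ (by simpa using hq 0)
  refine ⟨Polynomial.C a, C_mem_polyGrading ha, ?_⟩
  rw [pow_one, X_dvd_iff, coeff_sub, mul_coeff_zero, coeff_zero_eq_eval_zero (_ ^ t), eval_pow]
  simp [linForm, hab]

variable (k) in
theorem isUnit_natCast [CharZero k] (R : Type*) [CommRing R] [Algebra k R] {n : ℕ} (hn : n ≠ 0) :
    IsUnit (n : R) := by
  rw [← map_natCast (algebraMap k R) n]
  exact (IsUnit.mk0 (n : k) (Nat.cast_ne_zero.2 hn)).map _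

theorem X_pow_dvd_derivative {d : ℕ} {p : C[X]} (h : X ^ (d + 1) ∣ p) : X ^ d ∣ derivative p := by
  obtain ⟨r, rfl⟩ := h
  rw [derivative_mul, derivative_X_pow]
  refine dvd_add ?_ ?_
  · exact Dvd.dvd.mul_right (Dvd.intro_left _ rfl) _
  · exact Dvd.dvd.mul_right (pow_dvd_pow _ (Nat.le_succ d)) _

variable (k) in
theorem X_pow_succ_dvd_of_derivative [CharZero k] {d : ℕ} {p : C[X]} (hp : X ^ (d + 1) ∣ p)
    (h : X ^ (d + 1) ∣ derivative p) : X ^ (d + 2) ∣ p := by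
  rw [X_pow_dvd_iff] at hp h ⊢
  intro e he
  rcases Nat.lt_or_ge e (d + 1) with h' | h'
  · exact hp e h'
  · obtain rfl : e = d + 1 := by omega
    have := h d (Nat.lt_succ_self d)
    rw [coeff_derivative] at this
    have hu : IsUnit ((d : C) + 1) := by
      exact_mod_cast isUnit_natCast k C (Nat.succ_ne_zero d)
    exact (hu.mul_left_eq_zero).1 this

/-! ### Balance passes to truncated polynomial extensions -/

section CharZero

variable [CharZero k] {l : C} {d : ℕ} {i : ℤ} {t : ℕ}

/-- If `N ^ (t + 1) * p` vanishes modulo `X ^ (d + 2)`, its derivative `N ^ t * w`, with `w = N p' +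
(t + 1) p`, vanishes modulo `X ^ (d + 1)`, so `w` does by `h₁`. Then `N ^ (t + 2) * p'` vanishes
too, so `p'` does by `h₂`, and hence `p`. Both hypotheses have the same value of `2 * i + t`, which
is what makes the induction close. -/
theorem truncInj_succ
    (h₁ : TruncInj 𝒞 (linForm l (1 : k)) (d + 1) i t)
    (h₂ : TruncInj 𝒞 (linForm l (1 : k)) (d + 1) (i - 1) (t + 2))
    (hl : RaisesDegree 𝒞 l) :
    TruncInj 𝒞 (linForm l (1 : k)) (d + 2) i (t + 1) := by
  intro p hp hE
  set N := linForm l (1 : k) with hN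
  have hN' : derivative N = 1 := derivative_linForm_one l
  have hp' := derivative_mem_polyGrading hp
  set w := N * derivative p + ((t + 1 : ℕ) : C[X]) * p with hw
  have hwmem : w ∈ polyGrading 𝒞 i := by
    refine add_mem ?_ ?_
    · convert raisesDegree_linForm hl (1 : k) _ _ hp' using 2
      ring
    · rw [← nsmul_eq_mul]
      exact nsmul_mem hp _
  have hdE : derivative (N ^ (t + 1) * p) = N ^ t * w := by
    rw [derivative_mul, derivative_pow, hN', hw]
    simp only [Nat.add_sub_cancel, map_natCast]
    ring
  have hw0 : X ^ (d + 1) ∣ w := h₁ w hwmem (hdE ▸ X_pow_dvd_derivative hE)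
  have hE' : X ^ (d + 1) ∣ N ^ (t + 1) * p := (pow_dvd_pow _ (Nat.le_succ _)).trans hE
  have hv0 : X ^ (d + 1) ∣ derivative p := by
    refine h₂ _ hp' ?_
    have : N ^ (t + 2) * derivative p
        = N ^ (t + 1) * w - ((t + 1 : ℕ) : C[X]) * (N ^ (t + 1) * p) := by
      rw [hw]; ring
    rw [this]
    exact dvd_sub (hw0.mul_left _) (hE'.mul_left _)
  refine X_pow_succ_dvd_of_derivative k ?_ hv0
  have : X ^ (d + 1) ∣ ((t + 1 : ℕ) : C[X]) * p := by
    rw [← add_sub_cancel_left (N * derivative p) (((t + 1 : ℕ) : C[X]) * p)]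
    exact dvd_sub hw0 (hv0.mul_left _)
  exact ((isUnit_natCast k C[X] (Nat.succ_ne_zero t)).dvd_mul_left).1 this

/-- The Euler operator `X * d/dX` multiplies the coefficient of `X ^ (d + 1)` by `d + 1`, so this
combination cancels the lowest possible term of `r`. -/
theorem X_pow_dvd_euler {r : C[X]} {d : ℕ} (h : X ^ (d + 1) ∣ r) :
    X ^ (d + 2) ∣ ((d + 1 : ℕ) : C[X]) * r - X * derivative r := by
  obtain ⟨r, rfl⟩ := h
  refine ⟨-derivative r, ?_⟩
  rw [derivative_mul, derivative_X_pow]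
  simp only [Nat.add_sub_cancel, map_natCast]
  ring

/-- The hypotheses solve the differentiated equation for `w` and a companion equation for `v`. Then
`u = (w - N v) / (t + 1)` solves the original equation modulo `X ^ (d + 1)`, and an Euler-type
correction gains the last power of `X`. -/
theorem truncSurj_succ
    (h₁ : TruncSurj 𝒞 (linForm l (1 : k)) (d + 1) i t)
    (h₂ : TruncSurj 𝒞 (linForm l (1 : k)) (d + 1) (i - 1) (t + 2))
    (hl : RaisesDegree 𝒞 l) :
    TruncSurj 𝒞 (linForm l (1 : k)) (d + 2) i (t + 1) := by
  intro q hq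
  set N := linForm l (1 : k) with hN
  have hN' : derivative N = 1 := derivative_linForm_one l
  have hNmem := raisesDegree_linForm hl (1 : k)
  have hq' := derivative_mem_polyGrading hq
  obtain ⟨w, hw, hwq⟩ := h₁ (derivative q) (by convert hq' using 2; push_cast; ring)
  obtain ⟨v, hv, hvq⟩ := h₂ (N * derivative q - ((t + 1 : ℕ) : C[X]) * q) (by
    refine sub_mem ?_ ?_
    · convert hNmem _ _ hq' using 2
      push_cast; ring
    · rw [← nsmul_eq_mul]
      convert nsmul_mem hq (t + 1) using 2
      push_cast; ring)
  have hNv : N * v ∈ polyGrading 𝒞 i := by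
    convert hNmem _ _ hv using 2
    ring
  have hXmem : ∀ {z : C[X]}, z ∈ polyGrading 𝒞 (i - 1) → X * z ∈ polyGrading 𝒞 i := by
    intro z hz
    convert X_mul_mem_polyGrading hz using 2
    ring
  have key : ∀ (n : ℕ) (z : C[X]), ((n + 1 : ℕ) : C[X]) * (((n + 1 : ℕ) : k)⁻¹ • z) = z := by
    intro n z
    rw [← nsmul_eq_mul, ← Nat.cast_smul_eq_nsmul k, smul_smul,
      mul_inv_cancel₀ (Nat.cast_ne_zero.2 n.succ_ne_zero), one_smul]
  obtain ⟨u, hu, hut⟩ : ∃ u ∈ polyGrading 𝒞 i, ((t + 1 : ℕ) : C[X]) * u = w - N * v :=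
    ⟨_, Submodule.smul_mem _ (((t + 1 : ℕ) : k)⁻¹) (sub_mem hw hNv), key _ _⟩
  -- Chosen so that `(d + 1) (N ^ (t + 1) p - q)` is the Euler combination of the error `E` plus `X
  -- * (N ^ t w - q')`; both are divisible by `X ^ (d + 2)`.
  obtain ⟨p, hp, hpd⟩ : ∃ p ∈ polyGrading 𝒞 i, ((d + 1 : ℕ) : C[X]) * p
      = ((d + 1 : ℕ) : C[X]) * u - X * derivative u + X * v := by
    refine ⟨_, Submodule.smul_mem _ (((d + 1 : ℕ) : k)⁻¹) (add_mem (sub_mem ?_ ?_) ?_), key _ _⟩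
    · rw [← nsmul_eq_mul]; exact nsmul_mem hu _
    · exact hXmem (derivative_mem_polyGrading hu)
    · exact hXmem hv
  refine ⟨p, hp, ?_⟩
  set E := N ^ (t + 1) * u - q with hE
  have hE0 : X ^ (d + 1) ∣ E := by
    refine ((isUnit_natCast k C[X] (Nat.succ_ne_zero t)).dvd_mul_left).1 ?_
    have : ((t + 1 : ℕ) : C[X]) * E = N * (N ^ t * w - derivative q)
        - (N ^ (t + 2) * v - (N * derivative q - ((t + 1 : ℕ) : C[X]) * q)) := by
      rw [hE, mul_sub, mul_left_comm, hut]; ring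
    rw [Nat.succ_eq_add_one, this]
    exact dvd_sub (hwq.mul_left _) hvq
  have hE' : derivative E = N ^ t * (((t + 1 : ℕ) : C[X]) * u) + N ^ (t + 1) * derivative u
      - derivative q := by
    rw [hE, derivative_sub, derivative_mul, derivative_pow, hN']
    simp only [Nat.add_sub_cancel, map_natCast]
    ring
  refine ((isUnit_natCast k C[X] (Nat.succ_ne_zero d)).dvd_mul_left).1 ?_
  have : ((d + 1 : ℕ) : C[X]) * (N ^ (t + 1) * p - q)
      = (((d + 1 : ℕ) : C[X]) * E - X * derivative E) + X * (N ^ t * w - derivative q) := by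
    rw [mul_sub, mul_left_comm, hpd, hE', hut, hE]; ring
  rw [Nat.succ_eq_add_one, this]
  refine dvd_add (X_pow_dvd_euler hE0) ?_
  rw [pow_succ' X (d + 1)]
  exact mul_dvd_mul_left _ hwq

theorem Balanced.trunc {s : ℤ} (h : Balanced 𝒞 l s) (hl : RaisesDegree 𝒞 l) (d : ℕ) :
    (∀ (i : ℤ) (t : ℕ), 2 * i + t ≤ s + d → TruncInj 𝒞 (linForm l (1 : k)) (d + 1) i t) ∧
    (∀ (i : ℤ) (t : ℕ), s + d < 2 * i + t → TruncSurj 𝒞 (linForm l (1 : k)) (d + 1) i t) := by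
  induction d with
  | zero =>
    exact ⟨fun i t hit => truncInj_one (h.inj i t (by simpa using hit)),
      fun i t hit => truncSurj_one (h.surj i t (by simpa using hit))⟩
  | succ d ih =>
    refine ⟨?_, ?_⟩
    · rintro i (_ | t) hit
      · intro p _ hd; simpa using hd
      · refine truncInj_succ (ih.1 _ _ ?_) (ih.1 _ _ ?_) hl <;> push_cast at hit ⊢ <;> linarith
    · rintro i (_ | t) hit
      · intro q hq; exact ⟨q, by simpa using hq, by simp⟩
      · refine truncSurj_succ (ih.2 _ _ ?_) (ih.2 _ _ ?_) hl <;> push_cast at hit ⊢ <;> linarith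

end CharZero

end PolynomialGrading

/-! ### From powers of `l + cX` modulo `X ^ (g + 1)` back to powers of `l` -/

section Transfer

variable {k C : Type*} [Field k] [CommRing C] [Algebra k C] {𝒞 : ℤ → Submodule k C}
  {l : C} {c : k} {g t : ℕ} {i : ℤ}

/-- In the binomial expansion of `(l + cX) ^ (t + g)`, a term either contains `l ^ t` or is
divisible by `X ^ (g + 1)`. So an element of `C` killed by `l ^ t` is killed modulo `X ^ (g + 1)`.
-/
theorem TruncInj.powInj_add (h : TruncInj 𝒞 (linForm l c) (g + 1) i (t + g)) :
    PowInj 𝒞 l i t := by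
  intro a ha h0
  have := h _ (C_mem_polyGrading ha) (by
    rw [linForm, add_pow, Finset.sum_mul]
    refine Finset.dvd_sum fun m hm => ?_
    rcases Nat.lt_or_ge m t with hmt | hmt
    · refine Dvd.dvd.mul_right (Dvd.dvd.mul_right (Dvd.dvd.mul_left ?_ _) _) _
      rw [_root_.smul_pow]
      exact dvd_smul_of_dvd _ (pow_dvd_pow _ (by omega))
    · have hz : l ^ m * a = 0 := by
        obtain ⟨r, rfl⟩ := Nat.exists_eq_add_of_le' hmt
        rw [pow_add, mul_assoc, h0, mul_zero]
      rw [mul_assoc, mul_right_comm, ← C_pow, mul_left_comm (Polynomial.C (l ^ m)), ← C_mul, hz]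
      simp)
  simpa using (X_pow_dvd_iff.1 this) 0 (Nat.succ_pos g)

/-- Solve for the right-hand side `b * X ^ g`: the terms contributing to the coefficient of `X ^ g`
involve at most `X ^ g`, hence at least `l ^ t`. -/
theorem TruncSurj.powSurj_add (hl : RaisesDegree 𝒞 l)
    (h : TruncSurj 𝒞 (linForm l c) (g + 1) i (t + g)) : PowSurj 𝒞 l i t := by
  intro b hb
  obtain ⟨p, hp, hpb⟩ := h (Polynomial.C b * X ^ g)
    (C_mul_X_pow_mem_polyGrading hb (by push_cast; ring))
  have hc := (X_pow_dvd_iff.1 hpb) g (Nat.lt_succ_self g)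
  rw [coeff_sub, coeff_C_mul_X_pow, if_pos rfl, sub_eq_zero] at hc
  suffices hmem : ((linForm l c) ^ (t + g) * p).coeff g ∈
      (𝒞 i).map (LinearMap.mulLeft k (l ^ t)) by
    rw [hc] at hmem
    obtain ⟨a, ha, hab⟩ := hmem
    exact ⟨a, ha, by simpa using hab⟩
  rw [linForm, add_pow, Finset.sum_mul, finsetSum_coeff]
  refine sum_mem fun m hm => ?_
  have e1 : Polynomial.C l ^ m * (c • (X : C[X])) ^ (t + g - m) * (((t + g).choose m : ℕ) : C[X]) * p
      = ((t + g).choose m) • (c ^ (t + g - m) • (Polynomial.C (l ^ m) * (X ^ (t + g - m) * p))) := by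
    rw [_root_.smul_pow, nsmul_eq_mul, C_pow, Algebra.mul_smul_comm, smul_mul_assoc, smul_mul_assoc,
      Algebra.mul_smul_comm]
    congr 1; ring
  rw [e1, coeff_smul, coeff_smul]
  refine nsmul_mem (Submodule.smul_mem _ _ ?_) _
  rw [coeff_C_mul, coeff_X_pow_mul']
  split_ifs with hmg
  · rw [Finset.mem_range] at hm
    obtain ⟨e, rfl⟩ : ∃ e, m = t + e := ⟨m - t, by omega⟩
    rw [show g - (t + g - (t + e)) = e by omega]
    have hmem : l ^ e * p.coeff e ∈ 𝒞 i := by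
      convert hl.pow e (hp e) using 2
      ring
    exact ⟨_, hmem, by simp [pow_add, mul_assoc]⟩
  · simp

/-- The coefficients of `(1 + c X) ^ (-n)`. -/
def negBinom (c : k) (n e : ℕ) : k := (-1) ^ e * (n.multichoose e : k) * c ^ e

theorem negBinom_ne_zero [CharZero k] (hc : c ≠ 0) {n : ℕ} (e : ℕ) : negBinom c (n + 1) e ≠ 0 := by
  have : (n + 1).multichoose e ≠ 0 := by
    rw [Nat.multichoose_eq]
    exact (Nat.choose_pos (by omega)).ne'
  unfold negBinom
  refine mul_ne_zero (mul_ne_zero (pow_ne_zero _ (by simp)) (by exact_mod_cast this))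
    (pow_ne_zero _ hc)

/-- The truncation in degree `g` of the homogenised power series `l ^ (g + n) / (l + c X) ^ n`. -/
noncomputable def invPow (l : C) (c : k) (g n : ℕ) : C[X] :=
  ∑ e ∈ Finset.range (g + 1), negBinom c n e • (Polynomial.C (l ^ (g - e)) * X ^ e)

theorem coeff_invPow (l : C) (c : k) (g n e : ℕ) :
    (invPow l c g n).coeff e = if e ≤ g then negBinom c n e • l ^ (g - e) else 0 := by
  rw [invPow, finsetSum_coeff]
  simp only [coeff_smul, coeff_C_mul_X_pow, smul_ite, smul_zero]
  rw [Finset.sum_ite_eq]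
  simp

theorem linForm_pow_mul_invPow (l : C) (c : k) (g n : ℕ) :
    X ^ (g + 1) ∣ linForm l c ^ n * invPow l c g n - Polynomial.C (l ^ (g + n)) := by
  induction n with
  | zero =>
    rw [X_pow_dvd_iff]
    rintro (_ | e) he
    · simp [coeff_invPow, negBinom, -map_pow]
    · simp [coeff_invPow, negBinom, -map_pow]
  | succ n ih =>
    have step : X ^ (g + 1) ∣ linForm l c * invPow l c g (n + 1) - Polynomial.C l * invPow l c g n := by
      rw [X_pow_dvd_iff]
      rintro (_ | e) he
      · simp [linForm, coeff_invPow, negBinom]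
      · rw [linForm, add_mul, coeff_sub, coeff_add, coeff_C_mul, smul_mul_assoc, coeff_smul,
          coeff_X_mul, coeff_C_mul, coeff_invPow, coeff_invPow, coeff_invPow,
          if_pos (by omega), if_pos (by omega), if_pos (by omega)]
        obtain ⟨f, rfl⟩ : ∃ f, g = e + 1 + f := ⟨g - (e + 1), by omega⟩
        rw [show e + 1 + f - (e + 1) = f by omega, show e + 1 + f - e = f + 1 by omega,
          mul_smul_comm, mul_smul_comm, ← pow_succ', smul_smul, ← add_smul, ← sub_smul]
        convert zero_smul k _
        unfold negBinom
        -- Pascal's rule for `multichoose`: multiplying the series of `(1 + cX) ^ (-(n + 1))` by `1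
        -- + cX` gives that of `(1 + cX) ^ (-n)`.
        rw [Nat.multichoose_succ_succ]
        push_cast; ring
    have : linForm l c ^ (n + 1) * invPow l c g (n + 1) - Polynomial.C (l ^ (g + (n + 1)))
        = linForm l c ^ n * (linForm l c * invPow l c g (n + 1) - Polynomial.C l * invPow l c g n)
          + Polynomial.C l * (linForm l c ^ n * invPow l c g n - Polynomial.C (l ^ (g + n))) := by
      rw [← add_assoc, pow_succ l, C_mul]; ring
    rw [this]
    exact dvd_add (step.mul_left _) (ih.mul_left _)

/-- If `l ^ (t + 1 + g) * a = 0`, then `invPow l c g (t + 1) * a` is killed by `(l + cX) ^ (t + 1)`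
modulo `X ^ (g + 1)`. Its coefficient of `X ^ g` is a multiple of `a` that is nonzero as a scalar
because `c ≠ 0` and the characteristic is zero. -/
theorem TruncInj.powInj_sub [CharZero k] (hc : c ≠ 0) (hl : RaisesDegree 𝒞 l)
    (h : TruncInj 𝒞 (linForm l c) (g + 1) (i + g) (t + 1)) : PowInj 𝒞 l i (t + 1 + g) := by
  intro a ha h0
  have hmem : invPow l c g (t + 1) * Polynomial.C a ∈ polyGrading 𝒞 (i + g) := by
    intro e
    rw [coeff_mul_C, coeff_invPow]
    split_ifs with heg
    · rw [smul_mul_assoc]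
      refine Submodule.smul_mem _ _ ?_
      convert hl.pow (g - e) ha using 2
      push_cast [heg]; ring
    · simp
  have hd := h _ hmem (by
    have e0 : linForm l c ^ (t + 1) * (invPow l c g (t + 1) * Polynomial.C a)
        = (linForm l c ^ (t + 1) * invPow l c g (t + 1) - Polynomial.C (l ^ (g + (t + 1))))
          * Polynomial.C a := by
      rw [sub_mul, ← C_mul, add_comm g, h0]; simp [mul_assoc]
    rw [e0]
    exact (linForm_pow_mul_invPow l c g (t + 1)).mul_right _)
  have := (X_pow_dvd_iff.1 hd) g (Nat.lt_succ_self g)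
  rw [coeff_mul_C, coeff_invPow, if_pos le_rfl, Nat.sub_self, pow_zero, smul_mul_assoc,
    one_mul] at this
  exact (smul_eq_zero_iff_right (negBinom_ne_zero hc g)).1 this

/-- Multiply a solution of `(l + cX) ^ (t + 1) * p = b` by `invPow l c g (t + 1)` and compare
coefficients of `X ^ g`. -/
theorem TruncSurj.powSurj_sub [CharZero k] (hc : c ≠ 0)
    (h : TruncSurj 𝒞 (linForm l c) (g + 1) (i + g) (t + 1)) : PowSurj 𝒞 l i (t + 1 + g) := by
  intro b hb
  obtain ⟨p, hp, hpb⟩ := h (Polynomial.C b) (C_mem_polyGrading (by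
    convert hb using 2; push_cast; ring))
  have hd : X ^ (g + 1) ∣ Polynomial.C (l ^ (g + (t + 1))) * p
      - invPow l c g (t + 1) * Polynomial.C b := by
    have e0 : Polynomial.C (l ^ (g + (t + 1))) * p - invPow l c g (t + 1) * Polynomial.C b
        = invPow l c g (t + 1) * (linForm l c ^ (t + 1) * p - Polynomial.C b)
          - (linForm l c ^ (t + 1) * invPow l c g (t + 1) - Polynomial.C (l ^ (g + (t + 1)))) * p := by
      ring
    rw [e0]
    exact dvd_sub (hpb.mul_left _) ((linForm_pow_mul_invPow l c g (t + 1)).mul_right _)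
  have := (X_pow_dvd_iff.1 hd) g (Nat.lt_succ_self g)
  rw [coeff_sub, coeff_mul_C, coeff_C_mul, coeff_invPow, if_pos le_rfl, Nat.sub_self, pow_zero,
    smul_mul_assoc, one_mul, sub_eq_zero] at this
  refine ⟨(negBinom c (t + 1) g)⁻¹ • p.coeff g, Submodule.smul_mem _ _ ?_, ?_⟩
  · convert hp g using 2
    ring
  · rw [mul_smul_comm, add_comm (t + 1) g, this, smul_smul,
      inv_mul_cancel₀ (negBinom_ne_zero hc g), one_smul]

end Transfer

/-! ### Graded algebras of the form `C[X]/(X ^ d)` -/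

section TruncatedExtension

variable {k C C' : Type*} [Field k] [CommRing C] [Algebra k C] [CommRing C'] [Algebra k C']

/-- `π` identifies the graded algebra `C'` with `C[X]/(X ^ d)`. -/
structure IsTruncExt (𝒞 : ℤ → Submodule k C) (𝒞' : ℤ → Submodule k C') (d : ℕ)
    (π : C[X] →ₐ[k] C') : Prop where
  map_eq_zero : ∀ p, π p = 0 ↔ X ^ d ∣ p
  mem_iff : ∀ n x, x ∈ 𝒞' n ↔ ∃ p ∈ polyGrading 𝒞 n, π p = x

namespace IsTruncExt

variable {𝒞 : ℤ → Submodule k C} {𝒞' : ℤ → Submodule k C'} {d : ℕ} {π : C[X] →ₐ[k] C'}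

/-- A left inverse suffices: composing `β` with the evaluation map gives the quotient map of `C[X]`,
which bounds the kernel from above. The last two hypotheses match the gradings. -/
theorem of_inverse (f : C →ₐ[k] C') (x : C') (hx : x ^ d = 0)
    (β : C' →ₐ[k] C[X] ⧸ Ideal.span {(X : C[X]) ^ d})
    (hβ : ∀ a, β (f a) = Ideal.Quotient.mk _ (Polynomial.C a))
    (hβx : β x = Ideal.Quotient.mk _ X)
    (hmem : ∀ (n : ℤ) (e : ℕ), ∀ a ∈ 𝒞 n, f a * x ^ e ∈ 𝒞' (n + e))
    (hspan : ∀ n : ℤ, 𝒞' n ≤ Submodule.span k {y | ∃ e : ℕ, ∃ a ∈ 𝒞 (n - e), y = f a * x ^ e}) :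
    IsTruncExt 𝒞 𝒞' d (Polynomial.aevalTower f x) := by
  have hterm : ∀ (a : C) (e : ℕ), Polynomial.aevalTower f x
      (Polynomial.C a * X ^ e) = f a * x ^ e := fun a e => by simp
  refine ⟨fun p => ⟨fun hp => ?_, ?_⟩, fun n y => ⟨fun hy => ?_, ?_⟩⟩
  · have key : ∀ q : C[X], β (Polynomial.aevalTower f x q)
        = Ideal.Quotient.mk _ q := by
      intro q
      induction q using Polynomial.induction_on' with
      | add p q hp hq => rw [map_add, map_add, hp, hq, map_add]
      | monomial n a =>
        rw [← C_mul_X_pow_eq_monomial, hterm, map_mul β, map_pow β, hβ, hβx, map_mul, map_pow]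
    have := key p
    rw [hp, map_zero, eq_comm, Ideal.Quotient.eq_zero_iff_mem, Ideal.mem_span_singleton] at this
    exact this
  · rintro ⟨q, rfl⟩
    rw [map_mul, map_pow]
    simp [hx]
  · have := hspan n hy
    suffices y ∈ (polyGrading 𝒞 n).map (Polynomial.aevalTower f x).toLinearMap by
      simpa using this
    refine (Submodule.span_le.2 ?_) this
    rintro _ ⟨e, a, ha, rfl⟩
    exact ⟨_, C_mul_X_pow_mem_polyGrading ha (by ring), hterm a e⟩
  · rintro ⟨p, hp, rfl⟩
    rw [p.as_sum_range_C_mul_X_pow, map_sum]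
    refine sum_mem fun e _ => ?_
    rw [hterm]
    convert hmem _ e _ (hp e) using 2
    ring

variable (h : IsTruncExt 𝒞 𝒞' d π)
include h

theorem map_mem {n : ℤ} {p : C[X]} (hp : p ∈ polyGrading 𝒞 n) : π p ∈ 𝒞' n :=
  (h.mem_iff n _).2 ⟨p, hp, rfl⟩

theorem powInj_iff {N : C[X]} {i : ℤ} {t : ℕ} :
    PowInj 𝒞' (π N) i t ↔ TruncInj 𝒞 N d i t := by
  constructor
  · intro H p hp hd
    refine (h.map_eq_zero p).1 (H _ (h.map_mem hp) ?_)
    rwa [← map_pow, ← map_mul, h.map_eq_zero]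
  · intro H a ha h0
    obtain ⟨p, hp, rfl⟩ := (h.mem_iff _ _).1 ha
    rw [← map_pow, ← map_mul, h.map_eq_zero] at h0
    exact (h.map_eq_zero p).2 (H p hp h0)

theorem powSurj_iff {N : C[X]} {i : ℤ} {t : ℕ} :
    PowSurj 𝒞' (π N) i t ↔ TruncSurj 𝒞 N d i t := by
  constructor
  · intro H q hq
    obtain ⟨a, ha, hab⟩ := H _ (h.map_mem hq)
    obtain ⟨p, hp, rfl⟩ := (h.mem_iff _ _).1 ha
    refine ⟨p, hp, (h.map_eq_zero _).1 ?_⟩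
    rw [map_sub, map_mul, map_pow, hab, sub_self]
  · intro H b hb
    obtain ⟨q, hq, rfl⟩ := (h.mem_iff _ _).1 hb
    obtain ⟨p, hp, hd⟩ := H q hq
    refine ⟨π p, h.map_mem hp, ?_⟩
    rw [← h.map_eq_zero, map_sub, map_mul, map_pow, sub_eq_zero] at hd
    exact hd

theorem raisesDegree {l : C} (hl : RaisesDegree 𝒞 l) (c : k) :
    RaisesDegree 𝒞' (π (linForm l c)) := by
  intro i a ha
  obtain ⟨p, hp, rfl⟩ := (h.mem_iff _ _).1 ha
  rw [← map_mul]
  exact h.map_mem (raisesDegree_linForm hl c _ _ hp)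

theorem eq_bot {E : ℤ} (hE : ∀ n, E < n → 𝒞 n = ⊥) (n : ℤ) (hn : E + d < n) : 𝒞' n = ⊥ := by
  refine (Submodule.eq_bot_iff _).2 fun x hx => ?_
  obtain ⟨p, hp, rfl⟩ := (h.mem_iff _ _).1 hx
  rw [h.map_eq_zero, X_pow_dvd_iff]
  intro e he
  have := hp e
  rwa [hE _ (by omega), Submodule.mem_bot] at this

theorem balanced [CharZero k] {l : C} {s : ℤ} (hl : RaisesDegree 𝒞 l) (hB : Balanced 𝒞 l s)
    (hd : 1 ≤ d) : Balanced 𝒞' (π (linForm l (1 : k))) (s + d - 1) := by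
  obtain ⟨d, rfl⟩ := Nat.exists_eq_add_of_le' hd
  refine ⟨fun i t hit => h.powInj_iff.2 ((hB.trunc hl d).1 i t ?_),
    fun i t hit => h.powSurj_iff.2 ((hB.trunc hl d).2 i t ?_)⟩ <;> push_cast at hit <;> linarith

end IsTruncExt

end TruncatedExtension

/-! ### Integer indexing and tensor gradings -/

section Gradings

variable {k A B : Type*} [Field k] [CommRing A] [Algebra k A] [CommRing B] [Algebra k B]

/-- The extension of an `ℕ`-indexed grading to all integers, by zero. -/
def intGrading (𝒜 : ℕ → Submodule k A) (i : ℤ) : Submodule k A :=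
  if 0 ≤ i then 𝒜 i.toNat else ⊥

@[simp] theorem intGrading_natCast (𝒜 : ℕ → Submodule k A) (n : ℕ) :
    intGrading 𝒜 (n : ℤ) = 𝒜 n := by
  simp [intGrading]

theorem intGrading_of_neg (𝒜 : ℕ → Submodule k A) {i : ℤ} (hi : i < 0) :
    intGrading 𝒜 i = ⊥ := by
  simp [intGrading, not_le.2 hi]

theorem mem_intGrading {𝒜 : ℕ → Submodule k A} {i : ℤ} {x : A} :
    x ∈ intGrading 𝒜 i ↔ x = 0 ∨ ∃ m : ℕ, i = m ∧ x ∈ 𝒜 m := by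
  rcases lt_or_ge i 0 with hi | hi
  · rw [intGrading_of_neg 𝒜 hi, Submodule.mem_bot]
    refine ⟨Or.inl, ?_⟩
    rintro (h | ⟨m, rfl, -⟩)
    · exact h
    · omega
  · lift i to ℕ using hi
    rw [intGrading_natCast]
    refine ⟨fun h => Or.inr ⟨i, rfl, h⟩, ?_⟩
    rintro (rfl | ⟨m, hm, h⟩)
    · exact zero_mem _
    · rwa [Nat.cast_inj.1 hm]

theorem tmul_mem_tensorGrading {𝒜 : ℕ → Submodule k A} {ℬ : ℕ → Submodule k B} {i j : ℕ} {a : A}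
    {b : B} (ha : a ∈ 𝒜 i) (hb : b ∈ ℬ j) : a ⊗ₜ[k] b ∈ tensorGrading 𝒜 ℬ (i + j) :=
  Submodule.mem_iSup_of_mem (i, j) (Submodule.mem_iSup_of_mem (by simp)
    (Submodule.apply_mem_map₂ (TensorProduct.mk k A B) ha hb))

theorem tensorGrading_le {𝒜 : ℕ → Submodule k A} {ℬ : ℕ → Submodule k B} {n : ℕ}
    {S : Submodule k (A ⊗[k] B)}
    (h : ∀ i j, i + j = n → ∀ a ∈ 𝒜 i, ∀ b ∈ ℬ j, a ⊗ₜ[k] b ∈ S) : tensorGrading 𝒜 ℬ n ≤ S := by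
  refine iSup₂_le fun p hp => Submodule.map₂_le.2 fun a ha b hb => ?_
  exact h p.1 p.2 (by simpa using hp) a ha b hb

theorem raisesDegree_intGrading {𝒜 : ℕ → Submodule k A} [GradedAlgebra 𝒜] {l : A} (hl : l ∈ 𝒜 1) :
    RaisesDegree (intGrading 𝒜) l := by
  intro i a ha
  rw [mem_intGrading] at ha ⊢
  rcases ha with rfl | ⟨m, rfl, ha⟩
  · simp
  · refine Or.inr ⟨m + 1, by push_cast; rfl, ?_⟩
    rw [mul_comm]
    exact SetLike.mul_mem_graded ha hl

theorem intGrading_tensor_le {𝒜 : ℕ → Submodule k A} {ℬ : ℕ → Submodule k B} {n : ℤ}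
    {S : Submodule k (A ⊗[k] B)}
    (h : ∀ i j : ℕ, (i : ℤ) + j = n → ∀ a ∈ 𝒜 i, ∀ b ∈ ℬ j, a ⊗ₜ[k] b ∈ S) :
    intGrading (tensorGrading 𝒜 ℬ) n ≤ S := by
  intro x hx
  rcases mem_intGrading.1 hx with rfl | ⟨m, rfl, hx⟩
  · exact zero_mem _
  · exact tensorGrading_le (fun i j hij => h i j (by exact_mod_cast hij)) hx

end Gradings

/-! ### `A ⊗ k[x]/(x ^ d)` as a truncated extension -/

section TruncPoly

variable {k A : Type*} [Field k] [CommRing A] [Algebra k A]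

/-- The class of `x` in `k[x]/(x ^ d)`. -/
noncomputable def truncX (k : Type*) [Field k] (d : ℕ) : TruncPoly k d := Ideal.Quotient.mk _ X

theorem truncX_pow (d : ℕ) : truncX k d ^ d = 0 := by
  rw [truncX, ← map_pow, Ideal.Quotient.eq_zero_iff_mem]
  exact Ideal.mem_span_singleton_self _

theorem mem_truncPolyGrading {d n : ℕ} {y : TruncPoly k d} :
    y ∈ truncPolyGrading k d n ↔ ∃ c : k, y = c • truncX k d ^ n := by
  have key : ∀ c : k, Ideal.Quotient.mkₐ k (Ideal.span {(X : k[X]) ^ d}) (monomial n c)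
      = c • truncX k d ^ n := fun c => by
    rw [← C_mul_X_pow_eq_monomial, ← smul_eq_C_mul, map_smul, map_pow]
    rfl
  constructor
  · rintro ⟨_, ⟨c, rfl⟩, rfl⟩
    exact ⟨c, key c⟩
  · rintro ⟨c, rfl⟩
    exact ⟨_, ⟨c, rfl⟩, key c⟩

/-- The homomorphism out of `k[x]/(x ^ d)` sending `x` to an element with vanishing `d`-th power. -/
noncomputable def truncLift {B : Type*} [CommRing B] [Algebra k B] {d : ℕ} (v : B)
    (hv : v ^ d = 0) : TruncPoly k d →ₐ[k] B :=
  Ideal.Quotient.liftₐ _ (aeval v) fun p hp => by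
    obtain ⟨q, rfl⟩ := Ideal.mem_span_singleton.1 hp
    simp [hv]

theorem truncLift_truncX {B : Type*} [CommRing B] [Algebra k B] {d : ℕ} (v : B)
    (hv : v ^ d = 0) : truncLift v hv (truncX k d) = v := by
  have : truncLift v hv (truncX k d) = aeval (R := k) v X := rfl
  rw [this, aeval_X]

theorem mk_X_pow_eq_zero {C : Type*} [CommRing C] (d : ℕ) :
    (Ideal.Quotient.mk (Ideal.span {(X : C[X]) ^ d}) X) ^ d = 0 := by
  rw [← map_pow, Ideal.Quotient.eq_zero_iff_mem]
  exact Ideal.mem_span_singleton_self _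

theorem isTruncExt_truncPoly (𝒜 : ℕ → Submodule k A) (d : ℕ) :
    IsTruncExt (intGrading 𝒜) (intGrading (tensorGrading 𝒜 (truncPolyGrading k d))) d
      (aevalTower (Algebra.TensorProduct.includeLeft (R := k) (S := k) (A := A))
        (1 ⊗ₜ[k] truncX k d)) := by
  refine IsTruncExt.of_inverse _ _ (by simp [truncX_pow])
    (Algebra.TensorProduct.lift ((Ideal.Quotient.mkₐ k _).comp CAlgHom)
      (truncLift (Ideal.Quotient.mk _ X) (mk_X_pow_eq_zero d)) fun _ _ => Commute.all _ _)
    (fun a => by simp) (by simp [truncLift_truncX]) ?_ ?_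
  · intro n e a ha
    rcases mem_intGrading.1 ha with rfl | ⟨m, rfl, ha⟩
    · simp
    · rw [← Nat.cast_add, intGrading_natCast]
      simp only [Algebra.TensorProduct.includeLeft_apply, Algebra.TensorProduct.tmul_pow, one_pow,
        Algebra.TensorProduct.tmul_mul_tmul, mul_one, one_mul]
      exact tmul_mem_tensorGrading ha (mem_truncPolyGrading.2 ⟨1, by simp⟩)
  · refine fun n => intGrading_tensor_le fun i j hij a ha b hb => ?_
    obtain ⟨c, rfl⟩ := mem_truncPolyGrading.1 hb
    rw [TensorProduct.tmul_smul]
    refine Submodule.smul_mem _ _ (Submodule.subset_span ⟨j, a, ?_, by simp⟩)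
    rwa [← hij, add_sub_cancel_right, intGrading_natCast]

theorem finite_truncPoly (d : ℕ) : Module.Finite k (TruncPoly k d) :=
  (monic_X_pow d).finite_quotient

end TruncPoly

/-! ### Monomial complete intersections as iterated truncated extensions -/

section MonomialCI

variable {k A : Type*} [Field k] [CommRing A] [Algebra k A]

/-- The class of the variable `x_i` in `k[x_1, …, x_n]/(x_1 ^ d_1, …, x_n ^ d_n)`. -/
noncomputable def monomialX (k : Type*) [Field k] {n : ℕ} (d : Fin n → ℕ) (i : Fin n) :
    MonomialCI k d := Ideal.Quotient.mk _ (MvPolynomial.X i)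

theorem monomialX_pow {n : ℕ} (d : Fin n → ℕ) (i : Fin n) : monomialX k d i ^ d i = 0 := by
  rw [monomialX, ← map_pow, Ideal.Quotient.eq_zero_iff_mem]
  exact Ideal.subset_span ⟨i, rfl⟩

theorem monomialCIGrading_eq_span {n : ℕ} (d : Fin n → ℕ) (m : ℕ) :
    monomialCIGrading k d m = Submodule.span k
      {y | ∃ u : Fin n → ℕ, ∑ i, u i = m ∧ y = ∏ i, monomialX k d i ^ u i} := by
  have key : ∀ (u : Fin n →₀ ℕ) (c : k), Ideal.Quotient.mkₐ k
      (Ideal.span (Set.range fun i : Fin n => (MvPolynomial.X i : MvPolynomial (Fin n) k) ^ d i))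
      (MvPolynomial.monomial u c) = c • ∏ i, monomialX k d i ^ u i := by
    intro u c
    rw [MvPolynomial.monomial_eq, ← MvPolynomial.smul_eq_C_mul, map_smul,
      Finsupp.prod_fintype _ _ (by simp), map_prod]
    simp only [map_pow]
    rfl
  apply le_antisymm
  · rintro _ ⟨F, hF, rfl⟩
    rw [SetLike.mem_coe, MvPolynomial.mem_homogeneousSubmodule] at hF
    rw [F.as_sum, map_sum]
    refine sum_mem fun u hu => ?_
    rw [AlgHom.toLinearMap_apply, key]
    refine Submodule.smul_mem _ _ (Submodule.subset_span ⟨u, ?_, rfl⟩)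
    rw [← Finsupp.degree_eq_sum]
    by_contra hne
    exact (MvPolynomial.mem_support_iff.1 hu) (hF.coeff_eq_zero hne)
  · refine Submodule.span_le.2 ?_
    rintro _ ⟨u, hu, rfl⟩
    refine ⟨MvPolynomial.monomial (Finsupp.equivFunOnFinite.symm u) 1, ?_, ?_⟩
    · refine MvPolynomial.isHomogeneous_monomial _ ?_
      rw [Finsupp.degree_eq_sum]
      simpa using hu
    · rw [AlgHom.toLinearMap_apply, key]
      simp

/-- The homomorphism out of a monomial complete intersection given by the images of the
variables. -/
noncomputable def monomialLift {B : Type*} [CommRing B] [Algebra k B] {n : ℕ} {d : Fin n → ℕ}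
    (v : Fin n → B) (hv : ∀ i, v i ^ d i = 0) : MonomialCI k d →ₐ[k] B :=
  Ideal.Quotient.liftₐ _ (MvPolynomial.aeval v) fun p hp => by
    have : Ideal.span (Set.range fun i : Fin n =>
        (MvPolynomial.X i : MvPolynomial (Fin n) k) ^ d i)
        ≤ RingHom.ker (MvPolynomial.aeval (R := k) v) := by
      rw [Ideal.span_le]
      rintro _ ⟨i, rfl⟩
      simp [hv]
    exact this hp

@[simp] theorem monomialLift_monomialX {B : Type*} [CommRing B] [Algebra k B] {n : ℕ}
    {d : Fin n → ℕ} (v : Fin n → B) (hv : ∀ i, v i ^ d i = 0) (i : Fin n) :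
    monomialLift v hv (monomialX k d i) = v i := by
  have : monomialLift v hv (monomialX k d i) = MvPolynomial.aeval (R := k) v (MvPolynomial.X i) :=
    rfl
  rw [this, MvPolynomial.aeval_X]

theorem adjoin_monomialX {n : ℕ} (d : Fin n → ℕ) :
    Algebra.adjoin k (Set.range (monomialX k d)) = ⊤ := by
  have h := congrArg (Subalgebra.map (Ideal.Quotient.mkₐ k (Ideal.span (Set.range fun i : Fin n =>
    (MvPolynomial.X i : MvPolynomial (Fin n) k) ^ d i)))) (MvPolynomial.adjoin_range_X (R := k)
      (σ := Fin n))
  rw [AlgHom.map_adjoin, ← Set.range_comp, Algebra.map_top,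
    (AlgHom.range_eq_top _).2 (Ideal.Quotient.mkₐ_surjective k _)] at h
  exact h

theorem monomialCI_algHom_ext {B : Type*} [CommRing B] [Algebra k B] {n : ℕ} {d : Fin n → ℕ}
    {f g : MonomialCI k d →ₐ[k] B} (h : ∀ i, f (monomialX k d i) = g (monomialX k d i)) :
    f = g := by
  refine AlgHom.ext_of_adjoin_eq_top (adjoin_monomialX d) ?_
  rintro _ ⟨i, rfl⟩
  exact h i

theorem finite_monomialCI {n : ℕ} {d : Fin n → ℕ} (hd : ∀ i, 1 ≤ d i) :
    Module.Finite k (MonomialCI k d) := by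
  have h := fg_adjoin_of_finite (R := k) (Set.finite_range (monomialX k d)) (by
    rintro _ ⟨i, rfl⟩
    refine IsIntegral.of_pow (hd i) ?_
    rw [monomialX_pow]
    exact isIntegral_zero)
  rw [adjoin_monomialX] at h
  exact ⟨h⟩

/-- With no variables, the tensor product is presented as `A[X]/(X)`, which gives the induction on
variables a base of the same shape as its step. -/
theorem isTruncExt_monomialCI_zero (𝒜 : ℕ → Submodule k A) (d : Fin 0 → ℕ) :
    IsTruncExt (intGrading 𝒜) (intGrading (tensorGrading 𝒜 (monomialCIGrading k d))) 1
      (aevalTower (Algebra.TensorProduct.includeLeft (R := k) (S := k) (A := A)) 0) := by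
  refine IsTruncExt.of_inverse _ _ (by simp)
    (Algebra.TensorProduct.lift ((Ideal.Quotient.mkₐ k _).comp CAlgHom)
      (monomialLift (fun i => i.elim0) fun i => i.elim0) fun _ _ => Commute.all _ _)
    (fun a => by simp) ?_ ?_ ?_
  · rw [map_zero, eq_comm, Ideal.Quotient.eq_zero_iff_mem]
    exact Ideal.subset_span (by simp)
  · rintro n (_ | e) a ha
    · rcases mem_intGrading.1 ha with rfl | ⟨m, rfl, ha⟩
      · simp
      · rw [← Nat.cast_add, intGrading_natCast, pow_zero, mul_one]
        refine tmul_mem_tensorGrading ha ?_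
        rw [monomialCIGrading_eq_span]
        exact Submodule.subset_span ⟨fun i => i.elim0, by simp⟩
    · simp
  · refine fun n => intGrading_tensor_le fun i j hij a ha b hb => ?_
    suffices h : monomialCIGrading k d j ≤ (Submodule.span k {y | ∃ e : ℕ,
        ∃ a ∈ intGrading 𝒜 (n - e), y = Algebra.TensorProduct.includeLeft a * 0 ^ e}).comap
          (TensorProduct.mk k A _ a) from h hb
    rw [monomialCIGrading_eq_span, Submodule.span_le]
    rintro _ ⟨u, hu, rfl⟩
    obtain rfl : j = 0 := by simpa using hu.symm
    refine Submodule.subset_span ⟨0, a, ?_, by simp⟩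
    rwa [← hij, Nat.cast_zero, add_zero, sub_zero, intGrading_natCast]

/-- The inclusion of the monomial complete intersection in all variables but the first one. -/
noncomputable def monomialSucc (k : Type*) [Field k] {n : ℕ} (d : Fin (n + 1) → ℕ) :
    MonomialCI k (fun i => d (Fin.succ i)) →ₐ[k] MonomialCI k d :=
  monomialLift (fun i => monomialX k d i.succ) fun i => monomialX_pow d i.succ

/-- The homomorphism to `C[X]/(X ^ d_0)` sending the first variable to `X` and the other ones to
given elements of `C`. -/
noncomputable def monomialConsLift {C : Type*} [CommRing C] [Algebra k C] {n : ℕ}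
    {d : Fin (n + 1) → ℕ} (w : Fin n → C) (hw : ∀ i, w i ^ d i.succ = 0) :
    MonomialCI k d →ₐ[k] C[X] ⧸ Ideal.span {(X : C[X]) ^ d 0} :=
  monomialLift (Fin.cases (Ideal.Quotient.mk _ X) fun i => Ideal.Quotient.mk _ (Polynomial.C (w i)))
    fun i => by
      refine Fin.cases ?_ (fun i => ?_) i
      · exact mk_X_pow_eq_zero _
      · rw [Fin.cases_succ, ← map_pow, ← C_pow, hw]
        simp

@[simp] theorem monomialConsLift_zero {C : Type*} [CommRing C] [Algebra k C] {n : ℕ}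
    {d : Fin (n + 1) → ℕ} (w : Fin n → C) (hw : ∀ i, w i ^ d i.succ = 0) :
    monomialConsLift w hw (monomialX k d 0) = Ideal.Quotient.mk _ X := by
  simp [monomialConsLift]

@[simp] theorem monomialConsLift_succ {C : Type*} [CommRing C] [Algebra k C] {n : ℕ}
    {d : Fin (n + 1) → ℕ} (w : Fin n → C) (hw : ∀ i, w i ^ d i.succ = 0) (i : Fin n) :
    monomialConsLift w hw (monomialX k d i.succ) = Ideal.Quotient.mk _ (Polynomial.C (w i)) := by
  simp [monomialConsLift]

theorem isTruncExt_monomialCI_succ (𝒜 : ℕ → Submodule k A) {n : ℕ} (d : Fin (n + 1) → ℕ) :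
    IsTruncExt (intGrading (tensorGrading 𝒜 (monomialCIGrading k fun i => d (Fin.succ i))))
      (intGrading (tensorGrading 𝒜 (monomialCIGrading k d))) (d 0)
      (aevalTower (Algebra.TensorProduct.map (AlgHom.id k A) (monomialSucc k d))
        (1 ⊗ₜ[k] monomialX k d 0)) := by
  refine IsTruncExt.of_inverse _ _ (by simp [monomialX_pow])
    (Algebra.TensorProduct.lift ((Ideal.Quotient.mkₐ k _).comp
      (CAlgHom.comp Algebra.TensorProduct.includeLeft))
      (monomialConsLift (fun i => (1 : A) ⊗ₜ[k] monomialX k (fun i => d (Fin.succ i)) i)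
        fun i => by rw [Algebra.TensorProduct.tmul_pow, monomialX_pow]; simp) fun _ _ => Commute.all _ _)
    (fun a => ?_) (by simp [← Algebra.TensorProduct.one_def]) ?_ ?_
  · rw [← AlgHom.comp_apply]
    change _ = ((Ideal.Quotient.mkₐ k _).comp CAlgHom) a
    congr 1
    refine Algebra.TensorProduct.ext (by ext; simp) (monomialCI_algHom_ext fun i => ?_)
    simp [monomialSucc, ← Algebra.TensorProduct.one_def]
  · intro m e a ha
    rcases mem_intGrading.1 ha with rfl | ⟨m, rfl, ha⟩
    · simp
    · rw [← Nat.cast_add, intGrading_natCast]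
      suffices h : tensorGrading 𝒜 (monomialCIGrading k fun i => d (Fin.succ i)) m
          ≤ (tensorGrading 𝒜 (monomialCIGrading k d) (m + e)).comap
            ((LinearMap.mulRight k (((1 : A) ⊗ₜ[k] monomialX k d 0) ^ e)) ∘ₗ
              (Algebra.TensorProduct.map (AlgHom.id k A) (monomialSucc k d)).toLinearMap) from h ha
      refine tensorGrading_le fun i j hij a ha b hb => ?_
      rw [Submodule.mem_comap]
      simp only [LinearMap.comp_apply, AlgHom.toLinearMap_apply, Algebra.TensorProduct.map_tmul,
        LinearMap.mulRight_apply, Algebra.TensorProduct.tmul_pow, one_pow,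
        Algebra.TensorProduct.tmul_mul_tmul, mul_one, AlgHom.coe_id, id_eq]
      rw [← hij, add_assoc]
      refine tmul_mem_tensorGrading ha ?_
      suffices h : monomialCIGrading k (fun i => d (Fin.succ i)) j
          ≤ (monomialCIGrading k d (j + e)).comap
            ((LinearMap.mulRight k (monomialX k d 0 ^ e)) ∘ₗ (monomialSucc k d).toLinearMap) from
        h hb
      rw [monomialCIGrading_eq_span, monomialCIGrading_eq_span, Submodule.span_le]
      rintro _ ⟨u, hu, rfl⟩
      refine Submodule.subset_span ⟨Fin.cons e u, ?_, ?_⟩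
      · rw [Fin.sum_univ_succ]
        simp [hu, add_comm]
      · rw [Fin.prod_univ_succ]
        simp [monomialSucc, mul_comm]
  · refine fun m => intGrading_tensor_le fun i j hij a ha b hb => ?_
    refine (?_ : monomialCIGrading k d j ≤ (Submodule.span k _).comap
          (TensorProduct.mk k A _ a)) hb
    rw [monomialCIGrading_eq_span, Submodule.span_le]
    rintro _ ⟨u, hu, rfl⟩
    rw [Fin.sum_univ_succ] at hu
    refine Submodule.subset_span ⟨u 0,
      a ⊗ₜ[k] ∏ i : Fin n, monomialX k (fun i => d (Fin.succ i)) i ^ u i.succ, ?_, ?_⟩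
    · rw [show m - (u 0 : ℤ) = ((i + ∑ i : Fin n, u i.succ : ℕ) : ℤ) by
        rw [← hij, ← hu]; push_cast; ring, intGrading_natCast]
      refine tmul_mem_tensorGrading ha ?_
      rw [monomialCIGrading_eq_span]
      exact Submodule.subset_span ⟨_, rfl, rfl⟩
    · rw [Fin.prod_univ_succ]
      simp [monomialSucc, mul_comm]

end MonomialCI

/-! ### Full rank is a generic condition -/

section Genericity

variable {k V C : Type*} [Field k] [AddCommGroup V] [Module k V] [CommRing C] [Algebra k C]

theorem eventually_det_ne_zero [FiniteDimensional k V] (E : ℕ → Module.End k V) (n : ℕ)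
    (h : LinearMap.det (∑ j ∈ Finset.range n, (0 : k) ^ j • E j) ≠ 0) :
    ∀ᶠ s : k in Filter.cofinite, LinearMap.det (∑ j ∈ Finset.range n, s ^ j • E j) ≠ 0 := by
  classical
  let b := Module.finBasis k V
  let P : k[X] := Matrix.det (∑ j ∈ Finset.range n, (X : k[X]) ^ j •
    (LinearMap.toMatrix b b (E j)).map Polynomial.C)
  have hP : ∀ s : k, P.eval s = LinearMap.det (∑ j ∈ Finset.range n, s ^ j • E j) := by
    intro s
    rw [← LinearMap.det_toMatrix b, ← Polynomial.coe_evalRingHom, RingHom.map_det]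
    congr 1
    ext i j
    simp only [RingHom.mapMatrix_apply, Matrix.map_apply, Matrix.sum_apply, Matrix.smul_apply,
      map_sum, map_smul, smul_eq_mul, eval_mul, eval_pow, coe_evalRingHom, eval_X, eval_C]
  have hP0 : P ≠ 0 := by
    intro h0
    rw [← hP, h0, eval_zero] at h
    exact h rfl
  refine (Polynomial.finite_setOfPred_isRoot hP0).subset fun s hs => ?_
  simpa [Polynomial.IsRoot, hP] using hs

/-- The determinant of the composite is a polynomial in `s` with value `1` at `s = 0`, so it has
only finitely many roots. -/
theorem eventually_bijective [FiniteDimensional k V] (f : V →ₗ[k] C) (g : C →ₗ[k] V) (L L' : C)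
    (t : ℕ) (h : g ∘ₗ LinearMap.mulLeft k (L ^ t) ∘ₗ f = LinearMap.id) :
    ∀ᶠ s : k in Filter.cofinite,
      Function.Bijective (g ∘ₗ LinearMap.mulLeft k ((L + s • L') ^ t) ∘ₗ f) := by
  have key : ∀ s : k, g ∘ₗ LinearMap.mulLeft k ((L + s • L') ^ t) ∘ₗ f
      = ∑ j ∈ Finset.range (t + 1), s ^ j •
        (g ∘ₗ LinearMap.mulLeft k (L' ^ j * L ^ (t - j) * (t.choose j : C)) ∘ₗ f) := by
    intro s
    ext v
    rw [add_comm L, add_pow]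
    simp [Finset.sum_mul, _root_.smul_pow, LinearMap.sum_apply, mul_assoc]
  have h0 := eventually_det_ne_zero (fun j => g ∘ₗ LinearMap.mulLeft k
    (L' ^ j * L ^ (t - j) * (t.choose j : C)) ∘ₗ f) (t + 1) (by
      rw [← key, zero_smul, add_zero, h, LinearMap.det_id]
      exact one_ne_zero)
  filter_upwards [h0] with s hs
  rw [← key] at hs
  exact (Module.End.isUnit_iff _).1 (LinearMap.isUnit_iff_isUnit_det _ |>.2 hs.isUnit)

variable {𝒞 : ℤ → Submodule k C} {L L' : C} {i : ℤ} {t : ℕ}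

theorem PowInj.eventually [FiniteDimensional k C] (h : PowInj 𝒞 L i t) (L' : C) :
    ∀ᶠ s : k in Filter.cofinite, PowInj 𝒞 (L + s • L') i t := by
  obtain ⟨g, hg⟩ := LinearMap.exists_leftInverse_of_injective
    (LinearMap.mulLeft k (L ^ t) ∘ₗ (𝒞 i).subtype) (by
      rw [LinearMap.ker_eq_bot']
      rintro ⟨a, ha⟩ h0
      exact Subtype.ext (h a ha h0))
  filter_upwards [eventually_bijective _ g L L' t hg] with s hs a ha h0
  have := hs.1 (a₁ := ⟨a, ha⟩) (a₂ := 0) (by simp [h0])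
  simpa using this

theorem RaisesDegree.add_smul (hL : RaisesDegree 𝒞 L) (hL' : RaisesDegree 𝒞 L') (s : k) :
    RaisesDegree 𝒞 (L + s • L') := by
  intro i a ha
  rw [add_mul, smul_mul_assoc]
  exact add_mem (hL i a ha) (Submodule.smul_mem _ _ (hL' i a ha))

theorem PowSurj.eventually [FiniteDimensional k C] (h : PowSurj 𝒞 L i t) (hL : RaisesDegree 𝒞 L)
    (hL' : RaisesDegree 𝒞 L') : ∀ᶠ s : k in Filter.cofinite, PowSurj 𝒞 (L + s • L') i t := by
  let r : 𝒞 i →ₗ[k] 𝒞 (i + t) :=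
    (LinearMap.mulLeft k (L ^ t)).restrict fun a ha => hL.pow t ha
  obtain ⟨g, hg⟩ := LinearMap.exists_rightInverse_of_surjective r (by
    rw [LinearMap.range_eq_top]
    rintro ⟨b, hb⟩
    obtain ⟨a, ha, rfl⟩ := h b hb
    exact ⟨⟨a, ha⟩, rfl⟩)
  obtain ⟨q, hq⟩ := LinearMap.exists_leftInverse_of_injective (𝒞 (i + t)).subtype
    (Submodule.ker_subtype _)
  have hq' : ∀ x : C, ∀ hx : x ∈ 𝒞 (i + t), q x = ⟨x, hx⟩ := fun x hx =>
    LinearMap.congr_fun hq ⟨x, hx⟩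
  have h0 := eventually_bijective ((𝒞 i).subtype ∘ₗ g) q L L' t (by
    ext b
    have : L ^ t * (g b : C) = b := congrArg Subtype.val (LinearMap.congr_fun hg b)
    simp [this, hq'])
  filter_upwards [h0] with s hs b hb
  obtain ⟨a, ha⟩ := hs.2 ⟨b, hb⟩
  refine ⟨g a, (g a).2, ?_⟩
  have hmem := (hL.add_smul hL' s).pow t (g a).2
  simp only [LinearMap.comp_apply, LinearMap.mulLeft_apply, Submodule.subtype_apply,
    hq' _ hmem] at ha
  exact congrArg Subtype.val ha

/-- Multiplication by `L ^ t` on the piece of degree `i` is injective or surjective. -/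
def FullRank (𝒞 : ℤ → Submodule k C) (L : C) (i : ℤ) (t : ℕ) : Prop :=
  PowInj 𝒞 L i t ∨ PowSurj 𝒞 L i t

theorem FullRank.smul (h : FullRank 𝒞 L i t) {s : k} (hs : s ≠ 0) : FullRank 𝒞 (s • L) i t := by
  have hst : s ^ t ≠ 0 := pow_ne_zero _ hs
  rcases h with h | h
  · refine Or.inl fun a ha h0 => h a ha ?_
    rw [_root_.smul_pow, smul_mul_assoc] at h0
    exact (smul_eq_zero_iff_right hst).1 h0
  · refine Or.inr fun b hb => ?_
    obtain ⟨a, ha, rfl⟩ := h b hb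
    refine ⟨(s ^ t)⁻¹ • a, Submodule.smul_mem _ _ ha, ?_⟩
    rw [_root_.smul_pow, smul_mul_smul_comm, mul_inv_cancel₀ hst, one_smul]

theorem eventually_fullRank [FiniteDimensional k C] (T : Set ℕ) {E : ℤ}
    (hneg : ∀ n < 0, 𝒞 n = ⊥) (hE : ∀ n, E < n → 𝒞 n = ⊥) (hL : RaisesDegree 𝒞 L)
    (hL' : RaisesDegree 𝒞 L') (h : ∀ t ∈ T, ∀ i, FullRank 𝒞 L i t) :
    ∀ᶠ s : k in Filter.cofinite, ∀ t ∈ T, ∀ i, FullRank 𝒞 (L + s • L') i t := by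
  -- Only finitely many pairs `(i, t)` matter: for the others the source or the target is zero.
  have h0 : ∀ᶠ s : k in Filter.cofinite, ∀ p ∈ Finset.Icc 0 E ×ˢ Finset.range (E.toNat + 1),
      p.2 ∈ T → FullRank 𝒞 (L + s • L') p.1 p.2 := by
    rw [Filter.eventually_all_finset]
    intro p _
    by_cases hp : p.2 ∈ T
    · rcases h _ hp p.1 with h | h
      · filter_upwards [h.eventually L'] with s hs _ using Or.inl hs
      · filter_upwards [h.eventually hL hL'] with s hs _ using Or.inr hs
    · exact Filter.Eventually.of_forall fun s h => absurd h hp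
  filter_upwards [h0] with s hs t ht i
  rcases lt_or_ge i 0 with hi | hi
  · exact Or.inl (.of_eq_bot (hneg i hi))
  rcases lt_or_ge E i with hi' | hi'
  · exact Or.inl (.of_eq_bot (hE i hi'))
  rcases lt_or_ge E (i + t) with hit | hit
  · exact Or.inr (.of_eq_bot (hE _ hit))
  · refine hs (i, t) ?_ ht
    simp only [Finset.mem_product, Finset.mem_Icc, Finset.mem_range]
    omega

/-- Finitely many nonempty conditions, each stable under scaling and under generic perturbation,
hold simultaneously somewhere. -/
theorem exists_forall_of_generic [Infinite k] {Q : ℕ → V → Prop}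
    (hpert : ∀ n v w, Q n v → ∀ᶠ s : k in Filter.cofinite, Q n (v + s • w))
    (hscale : ∀ n v, ∀ s : k, s ≠ 0 → Q n v → Q n (s • v)) (hex : ∀ n, ∃ v, Q n v) (N : ℕ) :
    ∃ v, ∀ n < N, Q n v := by
  induction N with
  | zero => exact ⟨0, fun n hn => absurd hn (Nat.not_lt_zero n)⟩
  | succ N ih =>
    obtain ⟨v, hv⟩ := ih
    obtain ⟨w, hw⟩ := hex N
    have h1 : ∀ᶠ s : k in Filter.cofinite, ∀ n ∈ Finset.range N, Q n (v + s • w) :=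
      (Filter.eventually_all_finset _).2 fun n hn => hpert n v w (hv n (Finset.mem_range.1 hn))
    -- Since `v + s • w = s • (w + s⁻¹ • v)`, the same vector is also a generic perturbation of `w`,
    -- up to scaling.
    have h2 : ∀ᶠ s : k in Filter.cofinite, Q N (w + s⁻¹ • v) :=
      (inv_injective.tendsto_cofinite).eventually (hpert N w v hw)
    have h3 : ∀ᶠ s : k in Filter.cofinite, s ≠ 0 :=
      (Set.finite_singleton (0 : k)).subset fun s hs => by simpa using hs
    obtain ⟨s, hs1, hs2, hs3⟩ := (h1.and (h2.and h3)).exists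
    refine ⟨v + s • w, fun n hn => ?_⟩
    rcases Nat.lt_succ_iff_lt_or_eq.1 hn with hn | rfl
    · exact hs1 n (Finset.mem_range.2 hn)
    · have := hscale _ _ s hs3 hs2
      rwa [smul_add, smul_smul, mul_inv_cancel₀ hs3, one_smul, add_comm] at this

end Genericity

/-! ### Linear forms in the tensor products -/

section LinearForms

variable {k A : Type*} [Field k] [CommRing A] [Algebra k A] {𝒜 : ℕ → Submodule k A}

/-- The linear form `l + c x` in `A ⊗ k[x]/(x ^ d)`. -/
noncomputable def truncForm (d : ℕ) (l : A) (c : k) : A ⊗[k] TruncPoly k d :=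
  l ⊗ₜ 1 + c • 1 ⊗ₜ truncX k d

/-- The linear form `l + ∑ c_j x_j` in `A ⊗ k[x_1, …, x_n]/(x_1 ^ d_1, …, x_n ^ d_n)`. -/
noncomputable def monomialForm {n : ℕ} (d : Fin n → ℕ) (l : A) (c : Fin n → k) :
    A ⊗[k] MonomialCI k d :=
  l ⊗ₜ 1 + ∑ j, c j • 1 ⊗ₜ monomialX k d j

theorem aevalTower_linForm_truncPoly (d : ℕ) (l : A) (c : k) :
    aevalTower (Algebra.TensorProduct.includeLeft (R := k) (S := k) (A := A))
      (1 ⊗ₜ[k] truncX k d) (linForm l c) = truncForm d l c := by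
  simp [linForm, truncForm]

theorem aevalTower_linForm_monomialCI_zero (d : Fin 0 → ℕ) (l : A) (c : Fin 0 → k) (c' : k) :
    aevalTower (Algebra.TensorProduct.includeLeft (R := k) (S := k) (A := A)
      (B := MonomialCI k d)) 0 (linForm l c') = monomialForm d l c := by
  simp [linForm, monomialForm]

theorem aevalTower_linForm_monomialCI_succ {n : ℕ} (d : Fin (n + 1) → ℕ) (l : A)
    (c : Fin (n + 1) → k) :
    aevalTower (Algebra.TensorProduct.map (AlgHom.id k A) (monomialSucc k d))
        (1 ⊗ₜ[k] monomialX k d 0)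
        (linForm (monomialForm (fun i => d (Fin.succ i)) l fun i => c i.succ) (c 0))
      = monomialForm d l c := by
  rw [monomialForm, monomialForm, Fin.sum_univ_succ, linForm, map_add, aevalTower_C, map_smul,
    aevalTower_X, map_add, map_sum, Algebra.TensorProduct.map_tmul, map_one, add_assoc,
    add_comm (c 0 • _)]
  refine congrArg₂ _ rfl (congrArg₂ _ (Finset.sum_congr rfl fun j _ => ?_) rfl)
  rw [map_smul, Algebra.TensorProduct.map_tmul, monomialSucc, monomialLift_monomialX, map_one]

theorem tmul_mem_tensorGrading_of_eq {B : Type*} [CommRing B] [Algebra k B]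
    {ℬ : ℕ → Submodule k B} {i j n : ℕ} (h : i + j = n) {a : A} {b : B} (ha : a ∈ 𝒜 i)
    (hb : b ∈ ℬ j) : a ⊗ₜ[k] b ∈ tensorGrading 𝒜 ℬ n :=
  h ▸ tmul_mem_tensorGrading ha hb

theorem truncForm_mem {d : ℕ} {l : A} [GradedAlgebra 𝒜] (hl : l ∈ 𝒜 1) (c : k) :
    truncForm d l c ∈ tensorGrading 𝒜 (truncPolyGrading k d) 1 :=
  add_mem (tmul_mem_tensorGrading_of_eq (i := 1) (j := 0) rfl hl (mem_truncPolyGrading.2 ⟨1, by simp⟩))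
    (Submodule.smul_mem _ _ (tmul_mem_tensorGrading_of_eq (i := 0) (j := 1) rfl SetLike.GradedOne.one_mem
      (mem_truncPolyGrading.2 ⟨1, by simp⟩)))

theorem monomialX_mem {n : ℕ} (d : Fin n → ℕ) (j : Fin n) :
    monomialX k d j ∈ monomialCIGrading k d 1 := by
  rw [monomialCIGrading_eq_span]
  refine Submodule.subset_span ⟨Pi.single j 1, by simp, ?_⟩
  rw [Finset.prod_eq_single j] <;> simp +contextual

theorem monomialForm_mem {n : ℕ} {d : Fin n → ℕ} {l : A} [GradedAlgebra 𝒜] (hl : l ∈ 𝒜 1)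
    (c : Fin n → k) :
    monomialForm d l c ∈ tensorGrading 𝒜 (monomialCIGrading k d) 1 := by
  refine add_mem (tmul_mem_tensorGrading_of_eq (i := 1) (j := 0) rfl hl ?_) (sum_mem fun j _ => Submodule.smul_mem _ _
    (tmul_mem_tensorGrading_of_eq (i := 0) (j := 1) rfl SetLike.GradedOne.one_mem (monomialX_mem d j)))
  rw [monomialCIGrading_eq_span]
  exact Submodule.subset_span ⟨0, by simp, by simp⟩

theorem exists_eq_truncForm (h0 : 𝒜 0 = 1) {d : ℕ} {y : A ⊗[k] TruncPoly k d}
    (hy : y ∈ tensorGrading 𝒜 (truncPolyGrading k d) 1) :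
    ∃ l ∈ 𝒜 1, ∃ c : k, y = truncForm d l c := by
  have : tensorGrading 𝒜 (truncPolyGrading k d) 1
      ≤ (𝒜 1).map ((TensorProduct.mk k A (TruncPoly k d)).flip 1)
        ⊔ Submodule.span k {1 ⊗ₜ truncX k d} := by
    refine tensorGrading_le fun i j hij a ha b hb => ?_
    obtain ⟨c, rfl⟩ := mem_truncPolyGrading.1 hb
    rw [TensorProduct.tmul_smul]
    refine Submodule.smul_mem _ _ ?_
    rcases Nat.add_eq_one_iff.1 hij with ⟨rfl, rfl⟩ | ⟨rfl, rfl⟩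
    · rw [h0, Submodule.mem_one] at ha
      obtain ⟨r, rfl⟩ := ha
      rw [Algebra.algebraMap_eq_smul_one, ← TensorProduct.smul_tmul', pow_one]
      exact Submodule.mem_sup_right (Submodule.smul_mem _ _ (Submodule.mem_span_singleton_self _))
    · exact Submodule.mem_sup_left ⟨a, ha, by simp⟩
  obtain ⟨_, ⟨l, hl, rfl⟩, z, hz, rfl⟩ := Submodule.mem_sup.1 (this hy)
  obtain ⟨c, rfl⟩ := Submodule.mem_span_singleton.1 hz
  exact ⟨l, hl, c, rfl⟩

theorem exists_eq_monomialForm (h0 : 𝒜 0 = 1) {n : ℕ} {d : Fin n → ℕ} {y : A ⊗[k] MonomialCI k d}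
    (hy : y ∈ tensorGrading 𝒜 (monomialCIGrading k d) 1) :
    ∃ l ∈ 𝒜 1, ∃ c : Fin n → k, y = monomialForm d l c := by
  have : tensorGrading 𝒜 (monomialCIGrading k d) 1
      ≤ (𝒜 1).map ((TensorProduct.mk k A (MonomialCI k d)).flip 1)
        ⊔ Submodule.span k (Set.range fun j => 1 ⊗ₜ monomialX k d j) := by
    refine tensorGrading_le fun i j hij a ha b hb => ?_
    refine Submodule.mem_comap (f := TensorProduct.mk k A _ a).1 ?_
    revert b
    change monomialCIGrading k d j ≤ _
    rw [monomialCIGrading_eq_span, Submodule.span_le]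
    rintro _ ⟨u, hu, rfl⟩
    rw [SetLike.mem_coe, Submodule.mem_comap, TensorProduct.mk_apply]
    rcases Nat.add_eq_one_iff.1 hij with ⟨rfl, rfl⟩ | ⟨rfl, rfl⟩
    · rw [h0, Submodule.mem_one] at ha
      obtain ⟨r, rfl⟩ := ha
      obtain ⟨j, hj⟩ : ∃ j, u j ≠ 0 := by
        by_contra! hne
        simp [hne] at hu
      rw [← Finset.add_sum_erase _ _ (Finset.mem_univ j)] at hu
      have hz : ∀ i ∈ Finset.univ.erase j, u i = 0 := Finset.sum_eq_zero_iff.1 (by omega)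
      rw [← Finset.mul_prod_erase _ _ (Finset.mem_univ j), Finset.prod_eq_one fun i hi => by
        rw [hz i hi, pow_zero], show u j = 1 by omega, Algebra.algebraMap_eq_smul_one,
        ← TensorProduct.smul_tmul', pow_one, mul_one]
      exact Submodule.mem_sup_right (Submodule.smul_mem _ _ (Submodule.subset_span ⟨j, rfl⟩))
    · have hz : ∀ i ∈ Finset.univ, u i = 0 := Finset.sum_eq_zero_iff.1 hu
      rw [Finset.prod_eq_one fun i hi => by rw [hz i hi, pow_zero]]
      exact Submodule.mem_sup_left ⟨a, ha, by simp⟩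
  obtain ⟨_, ⟨l, hl, rfl⟩, z, hz, rfl⟩ := Submodule.mem_sup.1 (this hy)
  obtain ⟨c, rfl⟩ := (Submodule.mem_span_range_iff_exists_fun k).1 hz
  exact ⟨l, hl, c, rfl⟩

theorem raisesDegree_truncForm {l : A} (hl : RaisesDegree (intGrading 𝒜) l) (d : ℕ) (c : k) :
    RaisesDegree (intGrading (tensorGrading 𝒜 (truncPolyGrading k d))) (truncForm d l c) := by
  rw [← aevalTower_linForm_truncPoly]
  exact (isTruncExt_truncPoly 𝒜 d).raisesDegree hl c

theorem raisesDegree_monomialForm {l : A} (hl : RaisesDegree (intGrading 𝒜) l) {n : ℕ}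
    (d : Fin n → ℕ) (c : Fin n → k) :
    RaisesDegree (intGrading (tensorGrading 𝒜 (monomialCIGrading k d))) (monomialForm d l c) := by
  induction n with
  | zero =>
    rw [← aevalTower_linForm_monomialCI_zero d l c 0]
    exact (isTruncExt_monomialCI_zero 𝒜 d).raisesDegree hl 0
  | succ n ih =>
    rw [← aevalTower_linForm_monomialCI_succ]
    exact (isTruncExt_monomialCI_succ 𝒜 d).raisesDegree (ih _ _) _

theorem exists_monomialCI_eq_bot {E : ℤ} (hE : ∀ n, E < n → intGrading 𝒜 n = ⊥) {n : ℕ}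
    (d : Fin n → ℕ) :
    ∃ E', ∀ m, E' < m → intGrading (tensorGrading 𝒜 (monomialCIGrading k d)) m = ⊥ := by
  induction n with
  | zero => exact ⟨_, (isTruncExt_monomialCI_zero 𝒜 d).eq_bot hE⟩
  | succ n ih =>
    obtain ⟨E', hE'⟩ := ih fun i => d i.succ
    exact ⟨_, (isTruncExt_monomialCI_succ 𝒜 d).eq_bot hE'⟩

theorem Balanced.truncForm [CharZero k] {l : A} (hl : RaisesDegree (intGrading 𝒜) l) {s : ℤ}
    (h : Balanced (intGrading 𝒜) l s) {d : ℕ} (hd : 1 ≤ d) :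
    Balanced (intGrading (tensorGrading 𝒜 (truncPolyGrading k d))) (truncForm d l (1 : k))
      (s + d - 1) := by
  rw [← aevalTower_linForm_truncPoly]
  exact (isTruncExt_truncPoly 𝒜 d).balanced hl h hd

theorem Balanced.monomialForm [CharZero k] {l : A} (hl : RaisesDegree (intGrading 𝒜) l) {s : ℤ}
    (h : Balanced (intGrading 𝒜) l s) {n : ℕ} {d : Fin n → ℕ} (hd : ∀ i, 1 ≤ d i) :
    ∃ s', Balanced (intGrading (tensorGrading 𝒜 (monomialCIGrading k d)))
      (monomialForm d l fun _ => (1 : k)) s' := by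
  induction n with
  | zero =>
    rw [← aevalTower_linForm_monomialCI_zero d l _ 1]
    exact ⟨_, (isTruncExt_monomialCI_zero 𝒜 d).balanced hl h le_rfl⟩
  | succ n ih =>
    obtain ⟨s', hs'⟩ := ih (d := fun i => d i.succ) fun i => hd i.succ
    rw [← aevalTower_linForm_monomialCI_succ]
    exact ⟨_, (isTruncExt_monomialCI_succ 𝒜 d).balanced (raisesDegree_monomialForm hl _ _) hs'
      (hd 0)⟩

end LinearForms

/-! ### Full rank and dimensions -/

section Ranks

variable {k C : Type*} [Field k] [CommRing C] [Algebra k C]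
  {𝒞 : ℤ → Submodule k C} {L : C} {i : ℤ} {t : ℕ}

/-- Multiplication by `L ^ t` as a linear map between graded pieces. -/
def powMap (hL : RaisesDegree 𝒞 L) (i : ℤ) (t : ℕ) : 𝒞 i →ₗ[k] 𝒞 (i + t) :=
  (LinearMap.mulLeft k (L ^ t)).restrict fun _ ha => hL.pow t ha

theorem powInj_iff_injective (hL : RaisesDegree 𝒞 L) :
    PowInj 𝒞 L i t ↔ Function.Injective (powMap hL i t) := by
  rw [← LinearMap.ker_eq_bot, LinearMap.ker_eq_bot']
  refine ⟨fun h a h0 => Subtype.ext (h a a.2 (congrArg Subtype.val h0)), fun h a ha h0 => ?_⟩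
  exact congrArg Subtype.val (h ⟨a, ha⟩ (Subtype.ext h0))

theorem powSurj_iff_surjective (hL : RaisesDegree 𝒞 L) :
    PowSurj 𝒞 L i t ↔ Function.Surjective (powMap hL i t) := by
  refine ⟨fun h b => ?_, fun h b hb => ?_⟩
  · obtain ⟨a, ha, hab⟩ := h b b.2
    exact ⟨⟨a, ha⟩, Subtype.ext hab⟩
  · obtain ⟨a, ha⟩ := h ⟨b, hb⟩
    exact ⟨a, a.2, congrArg Subtype.val ha⟩

variable [FiniteDimensional k C]

theorem PowInj.finrank_le (hL : RaisesDegree 𝒞 L) (h : PowInj 𝒞 L i t) :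
    Module.finrank k (𝒞 i) ≤ Module.finrank k (𝒞 (i + t)) :=
  LinearMap.finrank_le_finrank_of_injective ((powInj_iff_injective hL).1 h)

theorem PowSurj.finrank_le (hL : RaisesDegree 𝒞 L) (h : PowSurj 𝒞 L i t) :
    Module.finrank k (𝒞 (i + t)) ≤ Module.finrank k (𝒞 i) :=
  LinearMap.finrank_le_finrank_of_surjective ((powSurj_iff_surjective hL).1 h)

theorem FullRank.powInj (hL : RaisesDegree 𝒞 L) (h : FullRank 𝒞 L i t)
    (hle : Module.finrank k (𝒞 i) ≤ Module.finrank k (𝒞 (i + t))) : PowInj 𝒞 L i t := by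
  rcases h with h | h
  · exact h
  · rw [powInj_iff_injective hL, LinearMap.injective_iff_surjective_of_finrank_eq_finrank
      (le_antisymm hle (h.finrank_le hL))]
    exact (powSurj_iff_surjective hL).1 h

theorem FullRank.powSurj (hL : RaisesDegree 𝒞 L) (h : FullRank 𝒞 L i t)
    (hle : Module.finrank k (𝒞 (i + t)) ≤ Module.finrank k (𝒞 i)) : PowSurj 𝒞 L i t := by
  rcases h with h | h
  · rw [powSurj_iff_surjective hL, ← LinearMap.injective_iff_surjective_of_finrank_eq_finrank
      (le_antisymm (h.finrank_le hL) hle)]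
    exact (powInj_iff_injective hL).1 h
  · exact h

end Ranks

/-! ### Hilbert functions and balanced forms -/

section Grading

variable {k A : Type*} [Field k] [CommRing A] [Algebra k A] {𝒜 : ℕ → Submodule k A}

theorem hilbert_eq (i : ℤ) : hilbert 𝒜 i = Module.finrank k (intGrading 𝒜 i) := by
  rcases lt_or_ge i 0 with hi | hi
  · rw [intGrading_of_neg 𝒜 hi, finrank_bot, hilbert, if_neg (not_le.2 hi)]
  · lift i to ℕ using hi
    rw [intGrading_natCast]
    simp [hilbert]

theorem mulFullRank_pow_iff {l : A} {i t : ℕ} :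
    MulFullRank 𝒜 (l ^ t) i (i + t) ↔ FullRank (intGrading 𝒜) l i t := by
  refine or_congr ⟨fun h a ha h0 => ?_, fun h a ha b hb hab => ?_⟩ ?_
  · rw [intGrading_natCast] at ha
    exact h ha (zero_mem _) (by simpa using h0)
  · refine sub_eq_zero.1 (h (a - b) (by simpa using sub_mem ha hb) ?_)
    rw [mul_sub, sub_eq_zero]
    exact hab
  · rw [PowSurj, ← Nat.cast_add, intGrading_natCast, intGrading_natCast]
    exact Iff.rfl

theorem fullRank_of_neg {l : A} {i : ℤ} (hi : i < 0) (t : ℕ) :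
    FullRank (intGrading 𝒜) l i t :=
  Or.inl (.of_eq_bot (intGrading_of_neg 𝒜 hi))

theorem hasSLP_iff :
    HasSLP 𝒜 ↔ ∃ l ∈ 𝒜 1, ∀ (t : ℕ) (i : ℤ), FullRank (intGrading 𝒜) l i t := by
  refine exists_congr fun l => and_congr_right fun _ => ⟨fun h t i => ?_, fun h t i => ?_⟩
  · rcases lt_or_ge i 0 with hi | hi
    · exact fullRank_of_neg hi t
    · lift i to ℕ using hi
      exact mulFullRank_pow_iff.1 (h t i)
  · exact mulFullRank_pow_iff.2 (h t i)

theorem hasWLP_iff :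
    HasWLP 𝒜 ↔ ∃ l ∈ 𝒜 1, ∀ i : ℤ, FullRank (intGrading 𝒜) l i 1 := by
  refine exists_congr fun l => and_congr_right fun _ => ⟨fun h i => ?_, fun h i => ?_⟩
  · rcases lt_or_ge i 0 with hi | hi
    · exact fullRank_of_neg hi 1
    · lift i to ℕ using hi
      refine mulFullRank_pow_iff.1 ?_
      rw [pow_one]
      exact h i
  · have := mulFullRank_pow_iff.2 (h i)
    rwa [pow_one] at this

theorem HasSLP.hasWLP (h : HasSLP 𝒜) : HasWLP 𝒜 := by
  obtain ⟨l, hl, h⟩ := hasSLP_iff.1 h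
  exact hasWLP_iff.2 ⟨l, hl, h 1⟩

theorem Balanced.fullRank {l : A} {s : ℤ} (h : Balanced (intGrading 𝒜) l s) (t : ℕ) (i : ℤ) :
    FullRank (intGrading 𝒜) l i t := by
  rcases le_or_gt (2 * i + t) s with hs | hs
  · exact Or.inl (h.inj i t hs)
  · exact Or.inr (h.surj i t hs)

theorem Balanced.isAlmostCentered [FiniteDimensional k A] {l : A}
    (hl : RaisesDegree (intGrading 𝒜) l) {s : ℤ} (h : Balanced (intGrading 𝒜) l s) :
    IsAlmostCentered 𝒜 := by
  have hle : ∀ i j : ℤ, i ≤ j → i + j ≤ s → hilbert 𝒜 i ≤ hilbert 𝒜 j := by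
    intro i j hij hs
    obtain ⟨t, rfl⟩ := Int.le.dest hij
    rw [hilbert_eq, hilbert_eq]
    exact (h.inj i t (by linarith)).finrank_le hl
  have hge : ∀ i j : ℤ, i ≤ j → s < i + j → hilbert 𝒜 j ≤ hilbert 𝒜 i := by
    intro i j hij hs
    obtain ⟨t, rfl⟩ := Int.le.dest hij
    rw [hilbert_eq, hilbert_eq]
    exact (h.surj i t (by linarith)).finrank_le hl
  refine ⟨fun i j hij hlt σ => hle _ _ (by omega) ?_, fun i j hij hlt σ => hge _ _ (by omega) ?_⟩
  · by_contra hs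
    exact absurd (hge i j hij.le (by omega)) (not_le.2 hlt)
  · by_contra hs
    exact absurd (hle i j hij.le (by omega)) (not_le.2 hlt)

/-- The dichotomy for the Hilbert function of an almost centered algebra of socle degree `D`. -/
theorem IsAlmostCentered.hilbert_dichotomy (h : IsAlmostCentered 𝒜) {D : ℕ}
    (h0 : hilbert 𝒜 0 = 1) (hD : hilbert 𝒜 D ≠ 0) (hD' : hilbert 𝒜 (D + 1) = 0) :
    (∀ i : ℕ, i ≤ D / 2 →
      hilbert 𝒜 ((i : ℤ) - 1) ≤ hilbert 𝒜 ((D : ℤ) - i) ∧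
      hilbert 𝒜 ((D : ℤ) - i) ≤ hilbert 𝒜 (i : ℤ)) ∨
    (∀ i : ℕ, i ≤ D / 2 →
      hilbert 𝒜 ((D : ℤ) - i + 1) ≤ hilbert 𝒜 (i : ℤ) ∧
      hilbert 𝒜 (i : ℤ) ≤ hilbert 𝒜 ((D : ℤ) - i)) := by
  by_cases hc : ∀ i : ℕ, i ≤ D / 2 → hilbert 𝒜 (i : ℤ) ≤ hilbert 𝒜 ((D : ℤ) - i)
  · refine Or.inr fun i hi => ⟨?_, hc i hi⟩
    by_contra! hlt
    -- Shifting outwards by `i` compares `h_0 = 1` with `h_{D+1} = 0`.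
    have := h.1 i (D - i + 1) (by omega) hlt i
    rw [sub_self, show (D : ℤ) - i + 1 + i = D + 1 by ring] at this
    omega
  · push Not at hc
    obtain ⟨i₀, hi₀, hlt₀⟩ := hc
    have hne : i₀ ≠ D - i₀ := by
      rintro he
      have : (i₀ : ℤ) = D - i₀ := by omega
      rw [← this] at hlt₀
      exact lt_irrefl _ hlt₀
    refine Or.inl fun i hi => ⟨?_, ?_⟩
    · by_contra! hlt
      -- Shifting outwards by `i` compares `h_{-1} = 0` with `h_D ≠ 0`.
      have := h.2 (i - 1) (D - i) (by omega) hlt i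
      rw [show (i : ℤ) - 1 - i = -1 by ring, show (D : ℤ) - i + i = D by ring] at this
      have h1 : hilbert 𝒜 (-1) = 0 := by simp [hilbert]
      omega
    · rcases le_total i i₀ with hle | hle
      · have := h.2 i₀ (D - i₀) (by omega) hlt₀ (i₀ - i)
        rwa [show (i₀ : ℤ) - (i₀ - i : ℕ) = i by omega,
          show (D : ℤ) - i₀ + (i₀ - i : ℕ) = D - i by omega] at this
      · by_contra! hlt
        have hne' : (i : ℤ) ≠ D - i := by
          intro he
          rw [← he] at hlt
          exact lt_irrefl _ hlt
        have := h.1 i (D - i) (by omega) hlt (i - i₀)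
        rw [show (i : ℤ) - (i - i₀ : ℕ) = i₀ by omega,
          show (D : ℤ) - i + (i - i₀ : ℕ) = D - i₀ by omega] at this
        omega

theorem PowInj.zero {C : Type*} [CommRing C] [Algebra k C] {𝒞 : ℤ → Submodule k C} {L : C}
    {i : ℤ} : PowInj 𝒞 L i 0 := fun a _ h => by simpa using h

theorem PowSurj.zero {C : Type*} [CommRing C] [Algebra k C] {𝒞 : ℤ → Submodule k C} {L : C}
    {i : ℤ} : PowSurj 𝒞 L i 0 := fun b hb => ⟨b, by simpa using hb, by simp⟩

/-- The Hilbert function inequalities decide which of injective and surjective holds for the map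
between two paired degrees. Any other map needed is a factor of such a map, sharing its source or
its target, and inherits the property. -/
theorem exists_balanced [FiniteDimensional k A] {l : A} (hl : RaisesDegree (intGrading 𝒜) l)
    (hfull : ∀ (t : ℕ) (i : ℤ), FullRank (intGrading 𝒜) l i t) {D : ℕ}
    (hD : ∀ n : ℤ, D < n → intGrading 𝒜 n = ⊥)
    (h : (∀ i : ℕ, i ≤ D / 2 →
        hilbert 𝒜 ((i : ℤ) - 1) ≤ hilbert 𝒜 ((D : ℤ) - i) ∧
        hilbert 𝒜 ((D : ℤ) - i) ≤ hilbert 𝒜 (i : ℤ)) ∨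
      (∀ i : ℕ, i ≤ D / 2 →
        hilbert 𝒜 ((D : ℤ) - i + 1) ≤ hilbert 𝒜 (i : ℤ) ∧
        hilbert 𝒜 (i : ℤ) ≤ hilbert 𝒜 ((D : ℤ) - i))) :
    ∃ s, Balanced (intGrading 𝒜) l s := by
  have hinj : ∀ i j : ℤ, ∀ t : ℕ, i + t ≤ j → hilbert 𝒜 i ≤ hilbert 𝒜 j →
      PowInj (intGrading 𝒜) l i t := by
    intro i j t hij hh
    obtain ⟨u, rfl⟩ := Int.le.dest (show i ≤ j by omega)
    rw [hilbert_eq, hilbert_eq] at hh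
    exact ((hfull u i).powInj hl hh).mono (by omega)
  have hsurj : ∀ i i' : ℤ, ∀ t : ℕ, i' ≤ i → hilbert 𝒜 (i + t) ≤ hilbert 𝒜 i' →
      PowSurj (intGrading 𝒜) l i t := by
    intro i i' t hii hh
    obtain ⟨u, hu⟩ := Int.le.dest (show i' ≤ i + t by omega)
    rw [← hu, hilbert_eq, hilbert_eq] at hh
    exact ((hfull u i').powSurj hl hh).mono hl (by omega) hu
  have hneg : ∀ (i : ℤ) (t : ℕ), i < 0 → PowInj (intGrading 𝒜) l i t := fun i t hi =>
    .of_eq_bot (intGrading_of_neg 𝒜 hi)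
  have hbig : ∀ (i : ℤ) (t : ℕ), D < i + t → PowSurj (intGrading 𝒜) l i t := fun i t hi =>
    .of_eq_bot (hD _ hi)
  rcases h with h | h
  -- Here the inequalities give injectivity for degree sum `D - 1` and surjectivity for sum `D`. In
  -- the other alternative the sums are `D` and `D + 1`.
  · refine ⟨D - 1, fun i t hit => ?_, fun i t hit => ?_⟩
    · rcases lt_or_ge i 0 with hi | hi
      · exact hneg i t hi
      lift i to ℕ using hi
      by_cases hi' : i + 1 ≤ D / 2
      · have := (h (i + 1) hi').1
        refine hinj i (D - (i + 1 : ℕ)) t (by omega) ?_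
        rwa [Nat.cast_succ, add_sub_cancel_right] at this
      · obtain rfl : t = 0 := by omega
        exact .zero
    · rcases lt_or_ge (D : ℤ) (i + t) with hj | hj
      · exact hbig i t hj
      obtain ⟨i', hi'⟩ := Int.le.dest hj
      refine hsurj i i' t (by omega) ?_
      have := (h i' (by omega)).2
      rwa [← hi', add_sub_cancel_right] at this
  · refine ⟨D, fun i t hit => ?_, fun i t hit => ?_⟩
    · rcases lt_or_ge i 0 with hi | hi
      · exact hneg i t hi
      lift i to ℕ using hi
      exact hinj i (D - i) t (by omega) (h i (by omega)).2
    · rcases lt_or_ge (D : ℤ) (i + t) with hj | hj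
      · exact hbig i t hj
      obtain ⟨i', hi'⟩ := Int.le.dest (show i + t ≤ (D : ℤ) + 1 by omega)
      by_cases hi'' : i' ≤ D / 2
      · refine hsurj i i' t (by omega) ?_
        have := (h i' hi'').1
        rwa [show (D : ℤ) - i' + 1 = i + t by omega] at this
      · obtain rfl : t = 0 := by omega
        exact .zero

end Grading

/-! ### Failure of balance -/

section Obstruction

variable {k C : Type*} [Field k] [CommRing C] [Algebra k C] {𝒞 : ℤ → Submodule k C} {L : C}

/-- If `L` is not balanced, then injectivity and surjectivity fail between degrees with the same
sum. -/
theorem exists_not_powInj_not_powSurj {D : ℕ} (hneg : ∀ n < 0, 𝒞 n = ⊥)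
    (hD : ∀ n : ℤ, D < n → 𝒞 n = ⊥) (h0 : 𝒞 0 ≠ ⊥) (hL : RaisesDegree 𝒞 L)
    (hB : ∀ s, ¬ Balanced 𝒞 L s) :
    ∃ (i i' : ℤ) (t t' : ℕ), ¬ PowInj 𝒞 L i (t + 1) ∧ ¬ PowSurj 𝒞 L i' (t' + 1) ∧
      2 * i + t = 2 * i' + t' ∧ t ≤ 2 * D ∧ t' ≤ 2 * D := by
  have hD1 : ¬ PowInj 𝒞 L 0 (D + 1) := by
    intro h
    refine h0 ((Submodule.eq_bot_iff _).2 fun a ha => h a ha ?_)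
    have := hL.pow (D + 1) ha
    rwa [hD _ (by push_cast; omega), Submodule.mem_bot] at this
  -- With `s` maximal for the injectivity half of `Balanced`, injectivity fails at sum `s + 1`.
  -- Since `l` is not balanced for this `s`, surjectivity fails at some sum above `s`.
  obtain ⟨s, hs, hmax⟩ := Int.exists_greatest_of_bdd
    (P := fun s => ∀ (i : ℤ) (t : ℕ), 2 * i + t ≤ s → PowInj 𝒞 L i t)
    ⟨D, fun s hs => by
      by_contra! hlt
      exact hD1 (hs 0 (D + 1) (by push_cast; omega))⟩
    ⟨-1, fun i t hit => .of_eq_bot (hneg i (by omega))⟩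
  have hsD : s ≤ D := by
    by_contra! hlt
    exact hD1 (hs 0 (D + 1) (by push_cast; omega))
  have hs1 : -1 ≤ s := hmax _ fun i t hit => .of_eq_bot (hneg i (by omega))
  obtain ⟨i, t, hit, hinj⟩ : ∃ (i : ℤ) (t : ℕ), 2 * i + t = s + 1 ∧ ¬ PowInj 𝒞 L i t := by
    by_contra! hne
    have := hmax (s + 1) fun i t hit => by
      rcases hit.lt_or_eq with h | h
      · exact hs i t (by omega)
      · exact hne i t h
    omega
  obtain ⟨i', t', hit', hsurj⟩ : ∃ (i' : ℤ) (t' : ℕ), s < 2 * i' + t' ∧ ¬ PowSurj 𝒞 L i' t' := by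
    by_contra! hne
    exact hB s ⟨hs, hne⟩
  -- Lowering the source degree by `r` with the target fixed keeps surjectivity false and brings the
  -- sum down to exactly `s + 1`.
  obtain ⟨r, hr⟩ := Int.le.dest (show s + 1 ≤ 2 * i' + t' by omega)
  have hsurj' : ¬ PowSurj 𝒞 L (i' - r) (t' + r) := fun h =>
    hsurj (h.mono hL (by omega) (by push_cast; ring))
  have hi : 0 ≤ i := by
    by_contra! hlt
    exact hinj (.of_eq_bot (hneg i hlt))
  have hj : i' + t' ≤ D := by
    by_contra! hlt
    exact hsurj (.of_eq_bot (hD _ hlt))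
  obtain ⟨t, rfl⟩ : ∃ u, t = u + 1 := Nat.exists_eq_succ_of_ne_zero (by
    rintro rfl; exact hinj .zero)
  obtain ⟨u, hu⟩ : ∃ u, t' + r = u + 1 := Nat.exists_eq_succ_of_ne_zero (by
    intro h; rw [h] at hsurj'; exact hsurj' .zero)
  rw [hu] at hsurj'
  exact ⟨i, i' - r, t, u, hinj, hsurj', by omega, by omega, by omega⟩

/-- Descent along single steps that change the exponent by one and preserve the midpoint up to
a half. -/
theorem descend_to_zero {G : ℕ → ℤ → ℕ → Prop} (hup : ∀ n i t, G (n + 1) i (t + 1) → G n i t)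
    (hdown : ∀ n i t, G (n + 1) (i + 1) (t + 1) → G n i (t + 2)) {g h t : ℕ} {i : ℤ}
    (hgh : t + g = h) (hG : G (g + h) (i + h) 1) : G 0 i (t + 1) := by
  have hdowns : ∀ (h g t : ℕ) (i : ℤ), G (g + h) (i + h) (t + 1) → G g i (t + 1 + h) := by
    intro h
    induction h with
    | zero => intro g t i hG; simpa using hG
    | succ h ih =>
      intro g t i hG
      have := ih (g + 1) t (i + 1) (by
        convert hG using 1
        · ring
        · push_cast; ring)
      have := hdown g i (t + h) (by convert this using 1; ring)
      convert this using 1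
      ring
  have hups : ∀ (g t : ℕ), G g i (t + g) → G 0 i t := by
    intro g
    induction g with
    | zero => intro t hG; simpa using hG
    | succ g ih => exact fun t hG => ih t (hup g i _ hG)
  -- The `h` steps of `hdown` lead from degree `i + h`, exponent `1`, to degree `i`, exponent `h +
  -- 1`; then `g` steps of `hup` lower the exponent to `h + 1 - g = t + 1`.
  refine hups g (t + 1) ?_
  have := hdowns h g 0 i hG
  convert this using 1
  omega

end Obstruction

/-! ### A common linear form, and balance from the Lefschetz properties -/

section Main

variable {k A : Type*} [Field k] [CommRing A] [Algebra k A] {𝒜 : ℕ → Submodule k A}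

theorem IsStandardGraded.finiteDimensional [IsArtinianRing A] [GradedAlgebra 𝒜]
    (hA : IsStandardGraded 𝒜) : FiniteDimensional k A := by
  obtain ⟨S, hS⟩ := Module.Finite.iff_fg.1 hA.finite_one
  have : Algebra.FiniteType k A := ⟨⟨S, by
    rw [← Algebra.adjoin_span, hS, hA.adjoin_one]⟩⟩
  exact Module.finite_of_isArtinianRing k A

theorem IsSocleDegree.eq_bot [FiniteDimensional k A] {D : ℕ} (hD : IsSocleDegree 𝒜 D) (n : ℤ)
    (hn : D < n) : intGrading 𝒜 n = ⊥ := by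
  lift n to ℕ using by omega
  rw [intGrading_natCast]
  by_contra hne
  have hmem : n ∈ {i : ℕ | Module.finrank k (𝒜 i) ≠ 0} := fun h =>
    hne (Submodule.finrank_eq_zero.1 h)
  have := hD.2 hmem
  omega

theorem IsSocleDegree.nontrivial {D : ℕ} (hD : IsSocleDegree 𝒜 D) : Nontrivial A := by
  by_contra hA
  rw [not_nontrivial_iff_subsingleton] at hA
  exact hD.1 (Module.finrank_zero_of_subsingleton)

theorem IsStandardGraded.hilbert_zero [GradedAlgebra 𝒜] (hA : IsStandardGraded 𝒜) [Nontrivial A] :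
    hilbert 𝒜 0 = 1 := by
  have : hilbert 𝒜 0 = Module.finrank k (𝒜 0) := by simp [hilbert]
  rw [this, hA.zero_eq, Submodule.one_eq_span]
  exact finrank_span_singleton one_ne_zero

theorem IsStandardGraded.intGrading_zero_ne_bot [GradedAlgebra 𝒜] (hA : IsStandardGraded 𝒜) [Nontrivial A] :
    intGrading 𝒜 0 ≠ ⊥ := by
  intro h
  have := hA.hilbert_zero
  rw [hilbert_eq, h] at this
  simp at this

variable (𝒜) in
/-- Some linear form `l + c x` with `c ≠ 0` is strong Lefschetz for `A ⊗ k[x]/(x ^ d)`. -/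
def TruncLefschetz (d : ℕ) (l : 𝒜 1) : Prop :=
  ∃ c : k, c ≠ 0 ∧ ∀ t ∈ (Set.univ : Set ℕ), ∀ i,
    FullRank (intGrading (tensorGrading 𝒜 (truncPolyGrading k d))) (truncForm d (l : A) c) i t

variable (𝒜) in
/-- Some linear form `l + ∑ c_j x_j` with all `c_j ≠ 0` is weak Lefschetz for
`A ⊗ k[x_1, …, x_n]/(x_1 ^ 2, …, x_n ^ 2)`. -/
def SquareLefschetz (n : ℕ) (l : 𝒜 1) : Prop :=
  ∃ c : Fin n → k, (∀ j, c j ≠ 0) ∧ ∀ t ∈ ({1} : Set ℕ), ∀ i,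
    FullRank (intGrading (tensorGrading 𝒜 (monomialCIGrading k fun _ : Fin n => 2)))
      (monomialForm (fun _ => 2) (l : A) c) i t

theorem eventually_add_ne_zero (c : k) : ∀ᶠ s : k in Filter.cofinite, c + s ≠ 0 :=
  (Set.finite_singleton (-c)).subset fun s hs => by
    have : c + s = 0 := by simpa using hs
    rw [Set.mem_singleton_iff]
    linear_combination this

theorem truncForm_add_smul (d : ℕ) (l l' : A) (c c' s : k) :
    truncForm d l c + s • truncForm d l' c' = truncForm d (l + s • l') (c + s * c') := by
  simp only [truncForm, TensorProduct.add_tmul, smul_add, add_smul, mul_smul,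
    TensorProduct.smul_tmul']
  abel

theorem monomialForm_add_smul {n : ℕ} (d : Fin n → ℕ) (l l' : A) (c c' : Fin n → k) (s : k) :
    monomialForm d l c + s • monomialForm d l' c' = monomialForm d (l + s • l') (c + s • c') := by
  simp only [monomialForm, TensorProduct.add_tmul, smul_add, add_smul, mul_smul, Pi.add_apply,
    Pi.smul_apply, smul_eq_mul, Finset.sum_add_distrib, Finset.smul_sum,
    ← TensorProduct.smul_tmul']
  abel

theorem powInj_of_square [CharZero k] {l : A} (hl : RaisesDegree (intGrading 𝒜) l)
    {g h t : ℕ} {i : ℤ} (hgh : t + g = h) {c : Fin (g + h) → k} (hc : ∀ j, c j ≠ 0)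
    (hinj : PowInj (intGrading (tensorGrading 𝒜 (monomialCIGrading k fun _ : Fin (g + h) => 2)))
      (monomialForm (fun _ => 2) l c) (i + h) 1) : PowInj (intGrading 𝒜) l i (t + 1) := by
  obtain ⟨c, -, h0⟩ := descend_to_zero (G := fun n i t => ∃ c : Fin n → k, (∀ j, c j ≠ 0) ∧
    PowInj (intGrading (tensorGrading 𝒜 (monomialCIGrading k fun _ : Fin n => 2)))
      (monomialForm (fun _ => 2) l c) i t)
    (by
      intro n i t
      rintro ⟨c, hc, H⟩
      rw [← aevalTower_linForm_monomialCI_succ, (isTruncExt_monomialCI_succ 𝒜 _).powInj_iff] at H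
      exact ⟨_, fun j => hc j.succ, H.powInj_add (g := 1)⟩)
    (by
      intro n i t
      rintro ⟨c, hc, H⟩
      rw [← aevalTower_linForm_monomialCI_succ, (isTruncExt_monomialCI_succ 𝒜 _).powInj_iff] at H
      exact ⟨_, fun j => hc j.succ, TruncInj.powInj_sub (g := 1) (hc 0)
        (raisesDegree_monomialForm hl _ _) H⟩)
    hgh ⟨c, hc, hinj⟩
  rw [← aevalTower_linForm_monomialCI_zero _ l c 0,
    (isTruncExt_monomialCI_zero 𝒜 _).powInj_iff] at h0
  exact h0.powInj_add (g := 0)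

theorem powSurj_of_square [CharZero k] {l : A} (hl : RaisesDegree (intGrading 𝒜) l)
    {g h t : ℕ} {i : ℤ} (hgh : t + g = h) {c : Fin (g + h) → k} (hc : ∀ j, c j ≠ 0)
    (hsurj : PowSurj (intGrading (tensorGrading 𝒜 (monomialCIGrading k fun _ : Fin (g + h) => 2)))
      (monomialForm (fun _ => 2) l c) (i + h) 1) : PowSurj (intGrading 𝒜) l i (t + 1) := by
  obtain ⟨c, -, h0⟩ := descend_to_zero (G := fun n i t => ∃ c : Fin n → k, (∀ j, c j ≠ 0) ∧
    PowSurj (intGrading (tensorGrading 𝒜 (monomialCIGrading k fun _ : Fin n => 2)))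
      (monomialForm (fun _ => 2) l c) i t)
    (by
      intro n i t
      rintro ⟨c, hc, H⟩
      rw [← aevalTower_linForm_monomialCI_succ, (isTruncExt_monomialCI_succ 𝒜 _).powSurj_iff] at H
      exact ⟨_, fun j => hc j.succ,
        TruncSurj.powSurj_add (g := 1) (raisesDegree_monomialForm hl _ _) H⟩)
    (by
      intro n i t
      rintro ⟨c, hc, H⟩
      rw [← aevalTower_linForm_monomialCI_succ, (isTruncExt_monomialCI_succ 𝒜 _).powSurj_iff] at H
      exact ⟨_, fun j => hc j.succ, TruncSurj.powSurj_sub (g := 1) (hc 0) H⟩)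
    hgh ⟨c, hc, hsurj⟩
  rw [← aevalTower_linForm_monomialCI_zero _ l c 0,
    (isTruncExt_monomialCI_zero 𝒜 _).powSurj_iff] at h0
  exact h0.powSurj_add hl (g := 0)

variable [GradedAlgebra 𝒜] [FiniteDimensional k A] {D : ℕ}

theorem eventually_fullRank_truncForm (hD : IsSocleDegree 𝒜 D) (T : Set ℕ) {d : ℕ} {l l' : A}
    (hl : l ∈ 𝒜 1) (hl' : l' ∈ 𝒜 1) {c : k} (c' : k)
    (h : ∀ t ∈ T, ∀ i, FullRank (intGrading (tensorGrading 𝒜 (truncPolyGrading k d)))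
      (truncForm d l c) i t) :
    ∀ᶠ s : k in Filter.cofinite, ∀ t ∈ T, ∀ i,
      FullRank (intGrading (tensorGrading 𝒜 (truncPolyGrading k d)))
        (truncForm d (l + s • l') (c + s * c')) i t := by
  have := finite_truncPoly (k := k) d
  simp only [← truncForm_add_smul]
  exact eventually_fullRank T (fun n hn => intGrading_of_neg _ hn)
    ((isTruncExt_truncPoly 𝒜 d).eq_bot hD.eq_bot)
    (raisesDegree_truncForm (raisesDegree_intGrading hl) d c)
    (raisesDegree_truncForm (raisesDegree_intGrading hl') d c') h

theorem eventually_fullRank_monomialForm (hD : IsSocleDegree 𝒜 D) (T : Set ℕ) {n : ℕ}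
    {d : Fin n → ℕ} (hd : ∀ i, 1 ≤ d i) {l l' : A} (hl : l ∈ 𝒜 1) (hl' : l' ∈ 𝒜 1)
    {c : Fin n → k} (c' : Fin n → k)
    (h : ∀ t ∈ T, ∀ i, FullRank (intGrading (tensorGrading 𝒜 (monomialCIGrading k d)))
      (monomialForm d l c) i t) :
    ∀ᶠ s : k in Filter.cofinite, ∀ t ∈ T, ∀ i,
      FullRank (intGrading (tensorGrading 𝒜 (monomialCIGrading k d)))
        (monomialForm d (l + s • l') (c + s • c')) i t := by
  have := finite_monomialCI (k := k) hd
  simp only [← monomialForm_add_smul]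
  obtain ⟨E, hE⟩ := exists_monomialCI_eq_bot (k := k) hD.eq_bot d
  exact eventually_fullRank T (fun n hn => intGrading_of_neg _ hn) hE
    (raisesDegree_monomialForm (raisesDegree_intGrading hl) d c)
    (raisesDegree_monomialForm (raisesDegree_intGrading hl') d c') h

theorem exists_truncLefschetz [CharZero k] (hA : IsStandardGraded 𝒜) (hD : IsSocleDegree 𝒜 D)
    (h : ∀ d : ℕ, 1 ≤ d → HasSLP (tensorGrading 𝒜 (truncPolyGrading k d))) (N : ℕ) :
    ∃ l, ∀ n < N, TruncLefschetz 𝒜 (n + 1) l := by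
  refine exists_forall_of_generic (k := k) (Q := fun n => TruncLefschetz 𝒜 (n + 1)) ?_ ?_ ?_ N
  · rintro n v w ⟨c, hc, hv⟩
    filter_upwards [eventually_fullRank_truncForm hD _ v.2 w.2 0 hv] with s hs
    exact ⟨c, hc, by simpa using hs⟩
  · rintro n v s hs ⟨c, hc, hv⟩
    refine ⟨s * c, mul_ne_zero hs hc, fun t ht i => ?_⟩
    have := (hv t ht i).smul hs
    rwa [← zero_add (s • truncForm _ _ _), show (0 : A ⊗[k] TruncPoly k (n + 1))
      = truncForm (n + 1) 0 0 by simp [truncForm], truncForm_add_smul, zero_add, zero_add] at this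
  · intro n
    obtain ⟨y, hy, hfull⟩ := hasSLP_iff.1 (h (n + 1) (Nat.le_add_left 1 n))
    obtain ⟨l, hl, c, rfl⟩ := exists_eq_truncForm hA.zero_eq hy
    -- Perturbing by `x` alone leaves `l` unchanged and makes the coefficient of `x` nonzero.
    have h1 := eventually_fullRank_truncForm hD Set.univ hl (zero_mem _) 1
      fun t _ i => hfull t i
    obtain ⟨s, hs, hcs⟩ := (h1.and (eventually_add_ne_zero c)).exists
    exact ⟨⟨l, hl⟩, c + s, hcs, by simpa using hs⟩

theorem exists_squareLefschetz [CharZero k] (hA : IsStandardGraded 𝒜) (hD : IsSocleDegree 𝒜 D)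
    (h : ∀ n : ℕ, HasWLP (tensorGrading 𝒜 (monomialCIGrading k fun _ : Fin n => 2))) (N : ℕ) :
    ∃ l, ∀ n < N, SquareLefschetz 𝒜 n l := by
  refine exists_forall_of_generic (k := k) (Q := SquareLefschetz 𝒜) ?_ ?_ ?_ N
  · rintro n v w ⟨c, hc, hv⟩
    filter_upwards [eventually_fullRank_monomialForm hD _ (fun _ => one_le_two) v.2 w.2 0 hv]
      with s hs
    exact ⟨c, hc, by simpa using hs⟩
  · rintro n v s hs ⟨c, hc, hv⟩
    refine ⟨s • c, fun j => mul_ne_zero hs (hc j), fun t ht i => ?_⟩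
    have := (hv t ht i).smul hs
    rwa [← zero_add (s • monomialForm _ _ _), show (0 : A ⊗[k] MonomialCI k fun _ : Fin n => 2)
      = monomialForm (fun _ => 2) 0 0 by simp [monomialForm], monomialForm_add_smul, zero_add,
      zero_add] at this
  · intro n
    obtain ⟨y, hy, hfull⟩ := hasWLP_iff.1 (h n)
    obtain ⟨l, hl, c, rfl⟩ := exists_eq_monomialForm hA.zero_eq hy
    have h1 := eventually_fullRank_monomialForm hD {1} (fun _ => one_le_two) hl (zero_mem _)
      (fun _ => 1) fun t ht i => by rw [Set.mem_singleton_iff.1 ht]; exact hfull i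
    have h2 : ∀ᶠ s : k in Filter.cofinite, ∀ j, c j + s ≠ 0 :=
      Filter.eventually_all.2 fun j => eventually_add_ne_zero (c j)
    obtain ⟨s, hs, hcs⟩ := (h1.and h2).exists
    exact ⟨⟨l, hl⟩, c + s • fun _ => 1, by simpa using hcs, by simpa using hs⟩

theorem HasSLP.exists_balanced (hS : HasSLP 𝒜) (hD : IsSocleDegree 𝒜 D)
    (h : (∀ i : ℕ, i ≤ D / 2 →
        hilbert 𝒜 ((i : ℤ) - 1) ≤ hilbert 𝒜 ((D : ℤ) - i) ∧
        hilbert 𝒜 ((D : ℤ) - i) ≤ hilbert 𝒜 (i : ℤ)) ∨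
      (∀ i : ℕ, i ≤ D / 2 →
        hilbert 𝒜 ((D : ℤ) - i + 1) ≤ hilbert 𝒜 (i : ℤ) ∧
        hilbert 𝒜 (i : ℤ) ≤ hilbert 𝒜 ((D : ℤ) - i))) :
    ∃ l ∈ 𝒜 1, ∃ s, Balanced (intGrading 𝒜) l s := by
  obtain ⟨l, hl, hfull⟩ := hasSLP_iff.1 hS
  exact ⟨l, hl, Lefschetz.exists_balanced (raisesDegree_intGrading hl) hfull hD.eq_bot h⟩

theorem exists_balanced_of_trunc [CharZero k] (hA : IsStandardGraded 𝒜) (hD : IsSocleDegree 𝒜 D)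
    (h : ∀ d : ℕ, 1 ≤ d → HasSLP (tensorGrading 𝒜 (truncPolyGrading k d))) :
    ∃ l ∈ 𝒜 1, ∃ s, Balanced (intGrading 𝒜) l s := by
  have := hD.nontrivial
  obtain ⟨⟨l, hl⟩, hfull⟩ := exists_truncLefschetz hA hD h (D + 1)
  have hlr := raisesDegree_intGrading hl
  refine ⟨l, hl, ?_⟩
  by_contra! hB
  obtain ⟨i, i', t, t', hinj, hsurj, hsum, ht, ht'⟩ := exists_not_powInj_not_powSurj
    (fun n hn => intGrading_of_neg 𝒜 hn) hD.eq_bot hA.intGrading_zero_ne_bot hlr hB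
  -- Half the difference of `t` and `t'` is the `g` for which `A ⊗ k[x]/(x ^ (g + 1))` has one map
  -- bearing on both failures: for `t ≤ t'`, its injectivity contradicts `hinj` by `powInj_add` and
  -- its surjectivity contradicts `hsurj` by `powSurj_sub`. The other case exchanges the two
  -- transfers.
  rcases le_total t t' with hle | hle
  · obtain ⟨g, hg⟩ : ∃ g : ℕ, i = i' + g := Int.le.dest (show i' ≤ i by omega) |>.imp fun _ h => h.symm
    obtain rfl : t' = t + g + g := by omega
    obtain ⟨c, hc, hfr⟩ := hfull g (by omega)
    rcases hfr (t + g + 1) trivial i with hf | hf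
    · rw [← aevalTower_linForm_truncPoly, (isTruncExt_truncPoly 𝒜 (g + 1)).powInj_iff] at hf
      refine hinj (TruncInj.powInj_add (g := g) (c := c) ?_)
      convert hf using 1
      ring
    · rw [← aevalTower_linForm_truncPoly, (isTruncExt_truncPoly 𝒜 (g + 1)).powSurj_iff] at hf
      refine hsurj ?_
      convert TruncSurj.powSurj_sub hc (hg ▸ hf) using 1
      ring
  · obtain ⟨g, hg⟩ : ∃ g : ℕ, i' = i + g := Int.le.dest (show i ≤ i' by omega) |>.imp fun _ h => h.symm
    obtain rfl : t = t' + g + g := by omega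
    obtain ⟨c, hc, hfr⟩ := hfull g (by omega)
    rcases hfr (t' + g + 1) trivial i' with hf | hf
    · rw [← aevalTower_linForm_truncPoly, (isTruncExt_truncPoly 𝒜 (g + 1)).powInj_iff] at hf
      refine hinj ?_
      convert TruncInj.powInj_sub hc hlr (hg ▸ hf) using 1
      ring
    · rw [← aevalTower_linForm_truncPoly, (isTruncExt_truncPoly 𝒜 (g + 1)).powSurj_iff] at hf
      refine hsurj (TruncSurj.powSurj_add (g := g) (c := c) hlr ?_)
      convert hf using 1
      ring

theorem exists_balanced_of_square [CharZero k] (hA : IsStandardGraded 𝒜)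
    (hD : IsSocleDegree 𝒜 D)
    (h : ∀ n : ℕ, HasWLP (tensorGrading 𝒜 (monomialCIGrading k fun _ : Fin n => 2))) :
    ∃ l ∈ 𝒜 1, ∃ s, Balanced (intGrading 𝒜) l s := by
  have := hD.nontrivial
  obtain ⟨⟨l, hl⟩, hfull⟩ := exists_squareLefschetz hA hD h (2 * D + 1)
  have hlr := raisesDegree_intGrading hl
  refine ⟨l, hl, ?_⟩
  by_contra! hB
  obtain ⟨i, i', t, t', hinj, hsurj, hsum, ht, ht'⟩ := exists_not_powInj_not_powSurj
    (fun n hn => intGrading_of_neg 𝒜 hn) hD.eq_bot hA.intGrading_zero_ne_bot hlr hB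
  -- Both failures must descend from the same degree and the same number of variables. The
  -- difference of `t` and `t'` is even by `hsum`, and padding the smaller one by half of it gives
  -- `max t t'` variables in total.
  obtain ⟨g, h, g', h', hn, hgh, hgh', hi, hN⟩ : ∃ g h g' h' : ℕ, g + h = g' + h' ∧
      t + g = h ∧ t' + g' = h' ∧ i + h = i' + h' ∧ g + h < 2 * D + 1 := by
    rcases le_total t t' with hle | hle
    · exact ⟨(t' - t) / 2, t + (t' - t) / 2, 0, t', by omega, by omega, by omega, by omega,
        by omega⟩
    · exact ⟨0, t, (t - t') / 2, t' + (t - t') / 2, by omega, by omega, by omega, by omega,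
        by omega⟩
  rcases hfull (g + h) hN with ⟨c, hc, hfr⟩
  rcases hfr 1 rfl (i + h) with hf | hf
  · exact hinj (powInj_of_square hlr hgh hc hf)
  · refine hsurj ?_
    rw [hi] at hf
    -- The number of variables occurs in the type of `c`, so `c` and what depends on it must be
    -- generalized before rewriting `g + h` to `g' + h'`.
    revert c
    rw [hn]
    intro c hc _ hf
    exact powSurj_of_square hlr hgh' hc hf

end Main

end Lefschetz

/-! ### The equivalence -/

theorem mainTheorem4 {k A : Type*} [Field k] [CharZero k] [CommRing A] [Algebra k A]
    [IsArtinianRing A] (𝒜 : ℕ → Submodule k A) [GradedAlgebra 𝒜]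
    (hA : Lefschetz.IsStandardGraded 𝒜) (D : ℕ) (hD : Lefschetz.IsSocleDegree 𝒜 D) :
    List.TFAE [
      Lefschetz.IsAlmostCentered 𝒜 ∧ Lefschetz.HasSLP 𝒜,
      Lefschetz.HasSLP 𝒜 ∧
        ((∀ i : ℕ, i ≤ D / 2 →
            Lefschetz.hilbert 𝒜 ((i : ℤ) - 1) ≤ Lefschetz.hilbert 𝒜 ((D : ℤ) - i) ∧
            Lefschetz.hilbert 𝒜 ((D : ℤ) - i) ≤ Lefschetz.hilbert 𝒜 (i : ℤ)) ∨
          (∀ i : ℕ, i ≤ D / 2 →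
            Lefschetz.hilbert 𝒜 ((D : ℤ) - i + 1) ≤ Lefschetz.hilbert 𝒜 (i : ℤ) ∧
            Lefschetz.hilbert 𝒜 (i : ℤ) ≤ Lefschetz.hilbert 𝒜 ((D : ℤ) - i))),
      ∀ d : ℕ, 1 ≤ d →
        Lefschetz.HasSLP (Lefschetz.tensorGrading 𝒜 (Lefschetz.truncPolyGrading k d)),
      ∀ (n : ℕ) (d : Fin n → ℕ), (∀ i, 1 ≤ d i) →
        Lefschetz.HasSLP (Lefschetz.tensorGrading 𝒜 (Lefschetz.monomialCIGrading k d)),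
      ∀ n : ℕ,
        Lefschetz.HasWLP (Lefschetz.tensorGrading 𝒜
          (Lefschetz.monomialCIGrading k (fun _ : Fin n => 2)))] := by
  have hfin : FiniteDimensional k A := hA.finiteDimensional
  have hnt : Nontrivial A := hD.nontrivial
  have toOne : (∃ l ∈ 𝒜 1, ∃ s, Lefschetz.Balanced (Lefschetz.intGrading 𝒜) l s) →
      Lefschetz.IsAlmostCentered 𝒜 ∧ Lefschetz.HasSLP 𝒜 := by
    rintro ⟨l, hl, s, hs⟩
    exact ⟨hs.isAlmostCentered (Lefschetz.raisesDegree_intGrading hl),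
      Lefschetz.hasSLP_iff.2 ⟨l, hl, hs.fullRank⟩⟩
  tfae_have 1 → 2 := by
    rintro ⟨hC, hS⟩
    refine ⟨hS, hC.hilbert_dichotomy hA.hilbert_zero ?_ ?_⟩
    · rw [Lefschetz.hilbert_eq, Lefschetz.intGrading_natCast]
      exact hD.1
    · rw [Lefschetz.hilbert_eq, hD.eq_bot _ (by omega), finrank_bot]
  tfae_have 2 → 3 := by
    rintro ⟨hS, hh⟩ d hd
    obtain ⟨l, hl, s, hs⟩ := hS.exists_balanced hD hh
    exact Lefschetz.hasSLP_iff.2 ⟨_, Lefschetz.truncForm_mem hl 1,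
      (hs.truncForm (Lefschetz.raisesDegree_intGrading hl) hd).fullRank⟩
  tfae_have 2 → 4 := by
    rintro ⟨hS, hh⟩ n d hd
    obtain ⟨l, hl, s, hs⟩ := hS.exists_balanced hD hh
    obtain ⟨s', hs'⟩ := hs.monomialForm (Lefschetz.raisesDegree_intGrading hl) hd
    exact Lefschetz.hasSLP_iff.2 ⟨_, Lefschetz.monomialForm_mem hl _, hs'.fullRank⟩
  tfae_have 3 → 1 := fun h => toOne (Lefschetz.exists_balanced_of_trunc hA hD h)
  tfae_have 4 → 5 := fun h n => (h n _ fun _ => one_le_two).hasWLP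
  tfae_have 5 → 1 := fun h => toOne (Lefschetz.exists_balanced_of_square hA hD h)
  tfae_finish
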